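/- Let $L\ge 6$ be an even integer and let $$G_L=\langle a,x,y,s,t\mid sas^{-1}=x,\ tat^{-1}=y,\ a^L=xy,\ [a,x]=[x,y]=[y,a]=1\rangle .$$ Let $X_L$ be the Cayley graph of $G_L$ with respect to $\{a,x,y,s,t\}$, considered as a metric graph with its path metric, where edges labelled $a,s,t$ have length $1$ and edges labelled $x,y$ have length $L$ (on vertices this is the word metric for the generating set $\{a,s,t\}$). For a non-principal ultrafilter $\omega$ on $\mathbb N$, a sequence $\mathbf o=(o_n)$ of points of $X_L$ and a sequence $\mathbf s=(s_n)$ of positive reals tending to infinity, the asymptotic cone $\mathrm{Cone}_\omega(X_L,\mathbf o,\mathbf s)$ is the set of sequences $(x_n)$ in $X_L$ for which $\lim_\omega d(x_n,o_n)/s_n$ is finite, with the metric $\lim_\omega d(x_n,y_n)/s_n$, sequences at distance $0$ being identified. Then some asymptotic cone of $X_L$ contains an isometrically embedded circle of length $1$ (with its length metric). More precisely, let $\sigma_{1,s}=sas^{-1}tat^{-1}$, $\sigma_{1,t}=tat^{-1}sas^{-1}$, and for $n\ge1$ $$\sigma_{n+1,s}=s\,\sigma_{n,s}\,s^{-1}\,t\,\sigma_{n,s}\,t^{-1},\qquad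 \sigma_{n+1,t}=t\,\sigma_{n,t}\,t^{-1}\,s\,\sigma_{n,t}\,s^{-1},$$ and let $\gamma_n:[0,\ell_n]\to X_L$ be the snowflake loop, i.e. the closed edge path based at $1$ that reads $\sigma_{n,s}$ followed by the reverse of $\sigma_{n,t}$, parametrized by arc length, where $\ell_n$ is its length. Then for every non-principal ultrafilter $\omega$, with constant observation point $1$ and scaling sequence $(\ell_n)_{n\ge1}$, the map $\tau\mapsto[(\gamma_n(\tau\ell_n))_{n\ge1}]$, $\tau\in[0,1]$, is well defined and induces an isometric embedding of the circle $\mathbb R/\mathbb Z$ with its length metric into $\mathrm{Cone}_\omega(X_L,1,(\ell_n))$. -/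

import Mathlib

/-! Asymptotic cones of metric spaces, the snowflake groups and their Cayley graphs. -/

open Filter Topology

noncomputable section

namespace Snowflake

/-! ### Asymptotic cones -/

/-- A scaling sequence: a sequence of positive real numbers tending to infinity. -/
structure ScalingSeq where
  seq : ℕ → ℝ
  pos : ∀ n, 0 < seq n
  tendsto : Tendsto seq atTop atTop

/-- The ultrafilter `ω` is not principal. -/
def NonPrincipal (ω : Ultrafilter ℕ) : Prop := ∀ n : ℕ, ω ≠ pure n

section Cone

variable {X : Type*} [MetricSpace X]

/-- Sequences `x` of points of `X` at finite distance from the sequence `o` of observation points: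
the rescaled distances `d (x n, o n) / s n` have a finite limit along `ω`. -/
def ConeSeq (ω : Ultrafilter ℕ) (o : ℕ → X) (s : ScalingSeq) : Type _ :=
  {x : ℕ → X // ∃ r : ℝ, Tendsto (fun n => dist (x n) (o n) / s.seq n) (ω : Filter ℕ) (𝓝 r)}

variable {ω : Ultrafilter ℕ} {o : ℕ → X} {s : ScalingSeq}

theorem ConeSeq.exists_limit (x y : ConeSeq ω o s) :
    ∃ r : ℝ, Tendsto (fun n => dist (x.1 n) (y.1 n) / s.seq n) (ω : Filter ℕ) (𝓝 r) := by
  obtain ⟨p, hp⟩ := x.2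
  obtain ⟨q, hq⟩ := y.2
  have h1 : ∀ᶠ n in (ω : Filter ℕ),
      dist (x.1 n) (y.1 n) / s.seq n ∈ Set.Icc (0 : ℝ) ((p + q) + 1) := by
    filter_upwards [(hp.add hq).eventually (gt_mem_nhds (lt_add_one (p + q)))] with n hn
    have hs := s.pos n
    refine ⟨by positivity, le_trans ?_ hn.le⟩
    rw [← add_div]
    gcongr
    exact dist_triangle_right _ _ _
  obtain ⟨r, -, hr⟩ := (isCompact_Icc (a := (0 : ℝ)) (b := (p + q) + 1)).ultrafilter_le_nhds
    (ω.map fun n => dist (x.1 n) (y.1 n) / s.seq n) (Filter.le_principal_iff.2 h1)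
  exact ⟨r, hr⟩

/-- The pseudometric `lim_ω d (x n, y n) / s n` on sequences. -/
def ConeSeq.coneDist (x y : ConeSeq ω o s) : ℝ :=
  limUnder (ω : Filter ℕ) fun n => dist (x.1 n) (y.1 n) / s.seq n

theorem ConeSeq.tendsto_coneDist (x y : ConeSeq ω o s) :
    Tendsto (fun n => dist (x.1 n) (y.1 n) / s.seq n) (ω : Filter ℕ) (𝓝 (x.coneDist y)) :=
  tendsto_nhds_limUnder (x.exists_limit y)

instance : PseudoMetricSpace (ConeSeq ω o s) where
  dist := ConeSeq.coneDist
  dist_self x := by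
    refine tendsto_nhds_unique (x.tendsto_coneDist x) ?_
    simp
  dist_comm x y := by
    refine tendsto_nhds_unique (x.tendsto_coneDist y) ?_
    simpa only [dist_comm] using y.tendsto_coneDist x
  dist_triangle x y z := by
    refine le_of_tendsto_of_tendsto' (x.tendsto_coneDist z)
      ((x.tendsto_coneDist y).add (y.tendsto_coneDist z)) fun n => ?_
    have hs := s.pos n
    rw [← add_div]
    gcongr
    exact dist_triangle _ _ _

/-- The asymptotic cone of `X` with respect to `ω`, the observation points `o` and the scaling
sequence `s`: sequences at distance zero from one another are identified. -/
abbrev AsymptoticCone (ω : Ultrafilter ℕ) (o : ℕ → X) (s : ScalingSeq) : Type _ :=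
  SeparationQuotient (ConeSeq ω o s)

end Cone

/-! ### Snowflake groups -/

/-- The five generators. -/
inductive Gen : Type
  | a | x | y | s | t

/-- The relators of the snowflake group with parameter `L`, that is, the relations
`s a s⁻¹ = x`, `t a t⁻¹ = y`, `a ^ L = x y`, `[a, x] = [x, y] = [y, a] = 1`. -/
def relators (L : ℕ) : Set (FreeGroup Gen) :=
  let a := FreeGroup.of Gen.a
  let x := FreeGroup.of Gen.x
  let y := FreeGroup.of Gen.y
  let s := FreeGroup.of Gen.s
  let t := FreeGroup.of Gen.t
  {s * a * s⁻¹ * x⁻¹, t * a * t⁻¹ * y⁻¹, a ^ L * (x * y)⁻¹,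
    a * x * a⁻¹ * x⁻¹, x * y * x⁻¹ * y⁻¹, y * a * y⁻¹ * a⁻¹}

/-- The snowflake group `G_L`. -/
abbrev SnowflakeGroup (L : ℕ) : Type := PresentedGroup (relators L)

/-- The element of `G_L` given by a generator. -/
abbrev gen (L : ℕ) (c : Gen) : SnowflakeGroup L := PresentedGroup.of c

/-- Words in the generators and their inverses; `(c, true)` is `c` and `(c, false)` is `c⁻¹`. -/
abbrev Word : Type := List (Gen × Bool)

/-- The element of `G_L` represented by a word. -/
def eval (L : ℕ) (w : Word) : SnowflakeGroup L := PresentedGroup.mk (relators L) (FreeGroup.mk w)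

/-! ### The Cayley graph, as a metric graph -/

/-- The lengths of the edges of the Cayley graph: `1` for the edges labelled `a`, `s`, `t`,
and `L` for those labelled `x`, `y`. -/
def edgeLength (L : ℕ) : Gen → ℕ
  | .a => 1
  | .s => 1
  | .t => 1
  | .x => L
  | .y => L

/-- The length of the edge path that reads the word `w`. -/
def wordLength (L : ℕ) (w : Word) : ℕ := (w.map fun l => edgeLength L l.1).sum

/-- The distance between two vertices of the Cayley graph: the least length of an edge path from
`g` to `h`. -/
def vertexDist (L : ℕ) (g h : SnowflakeGroup L) : ℕ :=
  sInf {n | ∃ w : Word, g * eval L w = h ∧ wordLength L w = n}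

theorem eval_append (L : ℕ) (v w : Word) : eval L (v ++ w) = eval L v * eval L w := by
  simp [eval, ← FreeGroup.mul_mk]

theorem eval_invRev (L : ℕ) (w : Word) : eval L (FreeGroup.invRev w) = (eval L w)⁻¹ := by
  simp [eval, ← FreeGroup.inv_mk]

theorem wordLength_append (L : ℕ) (v w : Word) :
    wordLength L (v ++ w) = wordLength L v + wordLength L w := by
  simp [wordLength]

theorem wordLength_invRev (L : ℕ) (w : Word) :
    wordLength L (FreeGroup.invRev w) = wordLength L w := by
  simp [wordLength, FreeGroup.invRev, Function.comp_def]

theorem eval_surjective (L : ℕ) : Function.Surjective (eval L) := fun g => by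
  obtain ⟨u, rfl⟩ := PresentedGroup.mk_surjective (relators L) g
  obtain ⟨w, rfl⟩ := Quot.mk_surjective u
  exact ⟨w, rfl⟩

theorem exists_geodesic (L : ℕ) (g h : SnowflakeGroup L) :
    ∃ w : Word, g * eval L w = h ∧ wordLength L w = vertexDist L g h := by
  obtain ⟨w, hw⟩ := eval_surjective L (g⁻¹ * h)
  exact Nat.sInf_mem (s := {n | ∃ w : Word, g * eval L w = h ∧ wordLength L w = n})
    ⟨_, w, by simp [hw], rfl⟩

theorem vertexDist_le (L : ℕ) {g h : SnowflakeGroup L} (w : Word) (hw : g * eval L w = h) :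
    vertexDist L g h ≤ wordLength L w :=
  Nat.sInf_le ⟨w, hw, rfl⟩

theorem vertexDist_self (L : ℕ) (g : SnowflakeGroup L) : vertexDist L g g = 0 := by
  have := vertexDist_le L (g := g) (h := g) []
    (by simp [eval, ← FreeGroup.one_eq_mk])
  simpa [wordLength] using this

theorem vertexDist_comm_le (L : ℕ) (g h : SnowflakeGroup L) :
    vertexDist L g h ≤ vertexDist L h g := by
  obtain ⟨w, hw, hl⟩ := exists_geodesic L h g
  rw [← hl, ← wordLength_invRev]
  exact vertexDist_le L _ (by simp [eval_invRev, ← hw])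

theorem vertexDist_comm (L : ℕ) (g h : SnowflakeGroup L) :
    vertexDist L g h = vertexDist L h g :=
  le_antisymm (vertexDist_comm_le L g h) (vertexDist_comm_le L h g)

theorem vertexDist_triangle (L : ℕ) (g h k : SnowflakeGroup L) :
    vertexDist L g k ≤ vertexDist L g h + vertexDist L h k := by
  obtain ⟨v, hv, hvl⟩ := exists_geodesic L g h
  obtain ⟨w, hw, hwl⟩ := exists_geodesic L h k
  rw [← hvl, ← hwl, ← wordLength_append]
  exact vertexDist_le L _ (by rw [eval_append, ← mul_assoc, hv, hw])

theorem vertexDist_edge (L : ℕ) (g : SnowflakeGroup L) (c : Gen) :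
    vertexDist L g (g * gen L c) ≤ edgeLength L c := by
  simpa [wordLength] using vertexDist_le L (g := g) (h := g * gen L c) [(c, true)]
    (by simp [eval, PresentedGroup.of, FreeGroup.of])

/-- A point of an edge of the Cayley graph: the edge labelled `label` goes from the vertex `base`
to the vertex `base * label`, and `pos` is the distance from `base` along the edge. -/
structure EdgePoint (L : ℕ) : Type where
  base : SnowflakeGroup L
  label : Gen
  pos : Set.Icc (0 : ℝ) (edgeLength L label)

namespace EdgePoint

variable {L : ℕ}

/-- The terminal vertex of the edge containing the point. -/
def target (p : EdgePoint L) : SnowflakeGroup L := p.base * gen L p.label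

/-- The length of the edge between the point and the terminal vertex. -/
def copos (p : EdgePoint L) : ℝ := edgeLength L p.label - p.pos

/-- The distance from a point of an edge to a vertex: a shortest path leaves the edge at one of
its two ends. -/
def distVertex (p : EdgePoint L) (v : SnowflakeGroup L) : ℝ :=
  min (p.pos + vertexDist L p.base v) (p.copos + vertexDist L p.target v)

/-- The least length of a path from `p` to `q` that goes through an end of the edge of `q`. -/
def distVia (p q : EdgePoint L) : ℝ :=
  min (p.distVertex q.base + q.pos) (p.distVertex q.target + q.copos)

open scoped Classical in
/-- The path metric of the Cayley graph: a shortest path between two points either passes through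
an end of the edge of each of them, or stays inside an edge that contains both. -/
def pathDist (p q : EdgePoint L) : ℝ :=
  if p.base = q.base ∧ p.label = q.label then min |(p.pos : ℝ) - q.pos| (p.distVia q)
  else p.distVia q

theorem pos_nonneg (p : EdgePoint L) : 0 ≤ (p.pos : ℝ) := p.pos.2.1

theorem copos_nonneg (p : EdgePoint L) : 0 ≤ p.copos := sub_nonneg.2 p.pos.2.2

theorem distVertex_nonneg (p : EdgePoint L) (v : SnowflakeGroup L) : 0 ≤ p.distVertex v := by
  have := p.pos_nonneg
  have := p.copos_nonneg
  exact le_min (by positivity) (by positivity)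

theorem distVertex_base (p : EdgePoint L) : p.distVertex p.base ≤ p.pos := by
  refine (min_le_left _ _).trans ?_
  simp [vertexDist_self]

theorem distVertex_target (p : EdgePoint L) : p.distVertex p.target ≤ p.copos := by
  refine (min_le_right _ _).trans ?_
  simp [vertexDist_self]

theorem distVertex_triangle (p : EdgePoint L) (v w : SnowflakeGroup L) :
    p.distVertex w ≤ p.distVertex v + vertexDist L v w := by
  have h1 : (vertexDist L p.base w : ℝ) ≤ vertexDist L p.base v + vertexDist L v w := by
    exact_mod_cast vertexDist_triangle L _ _ _
  have h2 : (vertexDist L p.target w : ℝ) ≤ vertexDist L p.target v + vertexDist L v w := by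
    exact_mod_cast vertexDist_triangle L _ _ _
  unfold distVertex
  rw [← min_add_add_right]
  exact min_le_min (by linarith) (by linarith)

theorem vertexDist_le_distVertex_add (p : EdgePoint L) (v w : SnowflakeGroup L) :
    (vertexDist L v w : ℝ) ≤ p.distVertex v + p.distVertex w := by
  have key : ∀ u z : SnowflakeGroup L,
      (vertexDist L v w : ℝ) ≤ vertexDist L u v + vertexDist L u z + vertexDist L z w := by
    intro u z
    have h := vertexDist_triangle L v z w
    have h' := vertexDist_triangle L v u z
    rw [vertexDist_comm L v u] at h'
    exact_mod_cast h.trans (by omega)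
  have he : (vertexDist L p.base p.target : ℝ) ≤ edgeLength L p.label := by
    exact_mod_cast vertexDist_edge L p.base p.label
  have h0 := p.pos_nonneg
  have h1 := p.copos_nonneg
  have hc : p.copos = edgeLength L p.label - p.pos := rfl
  have k1 := key p.base p.base
  have k2 := key p.base p.target
  have k3 := key p.target p.base
  have k4 := key p.target p.target
  rw [vertexDist_comm L p.target p.base] at k3
  simp only [vertexDist_self, Nat.cast_zero] at k1 k4
  unfold distVertex
  rcases min_choice ((p.pos : ℝ) + vertexDist L p.base v) (p.copos + vertexDist L p.target v)
    with h | h <;>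
  rcases min_choice ((p.pos : ℝ) + vertexDist L p.base w) (p.copos + vertexDist L p.target w)
    with h' | h' <;> rw [h, h'] <;> linarith

theorem distVia_le (p q : EdgePoint L) (v : SnowflakeGroup L) :
    p.distVia q ≤ p.distVertex v + q.distVertex v := by
  have h1 := p.distVertex_triangle v q.base
  have h2 := p.distVertex_triangle v q.target
  rw [vertexDist_comm] at h1 h2
  unfold distVia
  rcases min_choice ((q.pos : ℝ) + vertexDist L q.base v) (q.copos + vertexDist L q.target v)
    with h | h
  · refine (min_le_left _ _).trans ?_
    rw [distVertex.eq_def q, h]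
    linarith
  · refine (min_le_right _ _).trans ?_
    rw [distVertex.eq_def q, h]
    linarith

theorem exists_distVia (p q : EdgePoint L) :
    ∃ v, p.distVertex v + q.distVertex v = p.distVia q := by
  have h1 := q.distVertex_base
  have h2 := q.distVertex_target
  rcases min_choice (p.distVertex q.base + q.pos) (p.distVertex q.target + q.copos) with h | h
  · refine ⟨q.base, le_antisymm ?_ (distVia_le _ _ _)⟩
    rw [distVia, h]
    linarith
  · refine ⟨q.target, le_antisymm ?_ (distVia_le _ _ _)⟩
    rw [distVia, h]
    linarith

theorem distVia_comm (p q : EdgePoint L) : p.distVia q = q.distVia p := by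
  obtain ⟨v, hv⟩ := p.exists_distVia q
  obtain ⟨w, hw⟩ := q.exists_distVia p
  refine le_antisymm ?_ ?_
  · rw [← hw, add_comm]
    exact distVia_le _ _ _
  · rw [← hv, add_comm]
    exact distVia_le _ _ _

theorem distVia_triangle (p q r : EdgePoint L) : p.distVia r ≤ p.distVia q + q.distVia r := by
  obtain ⟨v, hv⟩ := p.exists_distVia q
  obtain ⟨w, hw⟩ := q.exists_distVia r
  have h1 := p.distVia_le r w
  have h2 := p.distVertex_triangle v w
  have h3 := q.vertexDist_le_distVertex_add v w
  linarith

theorem distVertex_le_of_edge (p q : EdgePoint L) (hb : p.base = q.base) (hl : p.label = q.label)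
    (v : SnowflakeGroup L) : p.distVertex v ≤ |(p.pos : ℝ) - q.pos| + q.distVertex v := by
  obtain ⟨g, c, t⟩ := p
  obtain ⟨g', c', t'⟩ := q
  obtain rfl : g = g' := hb
  obtain rfl : c = c' := hl
  have h1 := le_abs_self ((t : ℝ) - t')
  have h2 := neg_abs_le ((t : ℝ) - t')
  simp only [distVertex, copos, target]
  rw [← min_add_add_left]
  exact min_le_min (by linarith) (by linarith)

theorem distVia_le_of_edge (p q r : EdgePoint L) (hb : p.base = q.base) (hl : p.label = q.label) :
    p.distVia r ≤ |(p.pos : ℝ) - q.pos| + q.distVia r := by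
  obtain ⟨v, hv⟩ := q.exists_distVia r
  have h1 := p.distVia_le r v
  have h2 := p.distVertex_le_of_edge q hb hl v
  linarith

theorem pathDist_le_distVia (p q : EdgePoint L) : p.pathDist q ≤ p.distVia q := by
  unfold pathDist
  split_ifs
  · exact min_le_right _ _
  · exact le_rfl

theorem pathDist_cases (p q : EdgePoint L) :
    (p.pathDist q = p.distVia q) ∨
      (p.base = q.base ∧ p.label = q.label ∧ p.pathDist q = |(p.pos : ℝ) - q.pos|) := by
  unfold pathDist
  split_ifs with h
  · rcases min_choice |(p.pos : ℝ) - q.pos| (p.distVia q) with h' | h'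
    · exact Or.inr ⟨h.1, h.2, h'⟩
    · exact Or.inl h'
  · exact Or.inl rfl

theorem distVia_nonneg (p q : EdgePoint L) : 0 ≤ p.distVia q := by
  obtain ⟨v, hv⟩ := p.exists_distVia q
  have h1 := p.distVertex_nonneg v
  have h2 := q.distVertex_nonneg v
  linarith

theorem pathDist_comm (p q : EdgePoint L) : p.pathDist q = q.pathDist p := by
  have h : (p.base = q.base ∧ p.label = q.label) ↔ (q.base = p.base ∧ q.label = p.label) :=
    and_congr eq_comm eq_comm
  unfold pathDist
  rw [distVia_comm p q, abs_sub_comm]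
  by_cases h' : p.base = q.base ∧ p.label = q.label
  · rw [if_pos h', if_pos (h.1 h')]
  · rw [if_neg h', if_neg (mt h.2 h')]

theorem pathDist_triangle (p q r : EdgePoint L) :
    p.pathDist r ≤ p.pathDist q + q.pathDist r := by
  rcases p.pathDist_cases q with h1 | ⟨hb, hl, h1⟩ <;>
  rcases q.pathDist_cases r with h2 | ⟨hb', hl', h2⟩ <;> rw [h1, h2]
  · exact (pathDist_le_distVia _ _).trans (distVia_triangle _ _ _)
  · refine (pathDist_le_distVia _ _).trans ?_
    rw [distVia_comm p r, distVia_comm p q, add_comm, abs_sub_comm]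
    exact distVia_le_of_edge _ _ _ hb'.symm hl'.symm
  · exact (pathDist_le_distVia _ _).trans (distVia_le_of_edge _ _ _ hb hl)
  · rw [pathDist, if_pos ⟨hb.trans hb', hl.trans hl'⟩]
    exact (min_le_left _ _).trans (abs_sub_le _ _ _)

instance : PseudoMetricSpace (EdgePoint L) where
  dist := pathDist
  dist_self p := by
    simp [pathDist, distVia_nonneg]
  dist_comm := pathDist_comm
  dist_triangle := pathDist_triangle

end EdgePoint

/-- The snowflake graph `X_L`: the Cayley graph of `G_L` (with the edge lengths above) as a metric
graph. Edges are glued along their common ends, that is, points of edges at distance zero from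
one another are identified. -/
abbrev SnowflakeGraph (L : ℕ) : Type := SeparationQuotient (EdgePoint L)

/-- The point at distance `τ` from `g` on the edge from `g` to `g * c`
(for `0 ≤ τ ≤ edgeLength L c`). -/
def edgePoint (L : ℕ) (g : SnowflakeGroup L) (c : Gen) (τ : ℝ) : SnowflakeGraph L :=
  SeparationQuotient.mk ⟨g, c, Set.projIcc 0 _ (Nat.cast_nonneg _) τ⟩

/-- The vertex `g` of the Cayley graph. -/
def vertex (L : ℕ) (g : SnowflakeGroup L) : SnowflakeGraph L := edgePoint L g .a 0

/-- The edge path that starts at the vertex `g` and reads the word `w`, parametrized by arc length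
on `[0, wordLength L w]`. -/
def edgePath (L : ℕ) : SnowflakeGroup L → Word → ℝ → SnowflakeGraph L
  | g, [], _ => vertex L g
  | g, (c, true) :: w, τ =>
      if τ ≤ edgeLength L c then edgePoint L g c τ
      else edgePath L (g * gen L c) w (τ - edgeLength L c)
  | g, (c, false) :: w, τ =>
      if τ ≤ edgeLength L c then edgePoint L (g * (gen L c)⁻¹) c (edgeLength L c - τ)
      else edgePath L (g * (gen L c)⁻¹) w (τ - edgeLength L c)

/-! ### Snowflake loops -/

/-- The words `σ 0 = a`, `σ (n + 1) = u (σ n) u⁻¹ v (σ n) v⁻¹`. -/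
def snowflakeWord (u v : Gen) : ℕ → Word
  | 0 => [(.a, true)]
  | n + 1 => [(u, true)] ++ snowflakeWord u v n ++ [(u, false)] ++
      [(v, true)] ++ snowflakeWord u v n ++ [(v, false)]

/-- The `n`-th snowflake loop `σ_{n,s} + reverse of σ_{n,t}`, where `σ_{n,s}` starts with `s` and
`σ_{n,t}` starts with `t`. -/
def snowflakeLoopWord (n : ℕ) : Word :=
  snowflakeWord .s .t n ++ FreeGroup.invRev (snowflakeWord .t .s n)

/-- The `n`-th snowflake loop, starting at the vertex `1` and parametrized by arc length. -/
def snowflakeLoop (L n : ℕ) : ℝ → SnowflakeGraph L := edgePath L 1 (snowflakeLoopWord n)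

theorem wordLength_snowflakeWord (L : ℕ) {u v : Gen} (hu : edgeLength L u = 1)
    (hv : edgeLength L v = 1) (n : ℕ) : wordLength L (snowflakeWord u v n) + 4 = 5 * 2 ^ n := by
  induction n with
  | zero => simp [snowflakeWord, wordLength, edgeLength]
  | succ n ih =>
    simp only [snowflakeWord, wordLength_append, pow_succ]
    simp only [wordLength, List.map_cons, List.map_nil, List.sum_cons, List.sum_nil, hu, hv] at *
    omega

theorem wordLength_snowflakeLoopWord (L n : ℕ) :
    wordLength L (snowflakeLoopWord n) + 8 = 10 * 2 ^ n := by
  have h1 := wordLength_snowflakeWord L (u := .s) (v := .t) rfl rfl n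
  have h2 := wordLength_snowflakeWord L (u := .t) (v := .s) rfl rfl n
  rw [snowflakeLoopWord, wordLength_append, wordLength_invRev]
  omega

/-- The scaling sequence whose `n`-th term is the length of the snowflake loop of index
`n + 1`. -/
def snowflakeScaling (L : ℕ) : ScalingSeq where
  seq n := wordLength L (snowflakeLoopWord (n + 1))
  pos n := by
    have h := wordLength_snowflakeLoopWord L (n + 1)
    have h2 := Nat.one_le_two_pow (n := n + 1)
    have : 0 < wordLength L (snowflakeLoopWord (n + 1)) := by omega
    exact_mod_cast this
  tendsto := by
    refine tendsto_natCast_atTop_atTop.comp (tendsto_atTop_mono (fun n => ?_) tendsto_id)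
    have h := wordLength_snowflakeLoopWord L (n + 1)
    have h2 := Nat.lt_two_pow_self (n := n + 1)
    simp only [id]
    omega

end Snowflake

end

/-!
The snowflake loops are isometrically embedded on vertices (`vertexDist_loopPoint`). As the other
points of a loop are at distance at most one from its vertices, the rescaled loops converge to an
isometrically embedded circle in every asymptotic cone with the given scaling.

The group `G_L` is a double HNN extension of the free abelian group `⟨a, x, y⟩` with stable letters
`s` and `t`. All that is needed of its Bass–Serre tree is that the edges `X ^ k — X ^ k u` of the
Cayley graph, where `u` is a stable letter and `X = u a u⁻¹`, form a cut (`exists_isBranch`). No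
normal forms are used: every relator crosses this set of edges an even number of times, so the
parity of the number of crossings defines a function on the group. Hence a geodesic between
the two sides of the cut runs through one of these edges (`IsBranch.exists_crossing`).

Cutting geodesics in this way gives two estimates for lengths. First,
`hasCost_of_vertexDist_le`: an element of `⟨a, x, y⟩` is reached optimally by letters `a` and by
excursions `s a ^ q s⁻¹ = x ^ q` and `t a ^ r t⁻¹ = y ^ r`; for `x ^ q * y ^ r` two excursions are
optimal (`excursionLen_add_excursionLen_le`). Second, `a ^ (L ^ n)` has length `5 * 2 ^ n - 4`
(`five_mul_two_pow_le_aLen`; this fails for `L < 6`), so the two sides of a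
snowflake loop are geodesic.

The distance between points `p`, `q` on different sides of the loop of index `n + 1` is then bounded
from below by induction on `n` (`le_vertexDist_sides`). The sides are made of four copies of sides
of the loop of index `n`, which lie over the sides of the parallelogram with vertices `1`,
`x ^ M`, `x ^ M * y ^ M`, `y ^ M`, where `M = L ^ n`. If `p` and `q` lie over adjacent sides of the
parallelogram, then the bound follows from the triangle inequality, because the diagonal
`x ^ M — y ^ M` is as long as the two excursions. If `p` and `q` lie over opposite sides, then a
geodesic from `p` to `q` runs through the two parallel lines under them, and passing from one line
to the other costs as much as an excursion along the transverse direction plus a displacement along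
the line. So the distance from `p` to `q` exceeds the distance between the corresponding points
of the loop of index `n` by at least the same amount as for the distances along the two loops
(`vertexDist_add_le_opposite`).
-/

namespace Snowflake

/-! ### Left-invariance of the word metric -/

theorem vertexDist_mul_left (L : ℕ) (k g h : SnowflakeGroup L) :
    vertexDist L (k * g) (k * h) = vertexDist L g h := by
  simp only [vertexDist, mul_assoc, mul_right_inj]

theorem vertexDist_one_mul_le (L : ℕ) (g h : SnowflakeGroup L) :
    vertexDist L 1 (g * h) ≤ vertexDist L 1 g + vertexDist L 1 h := by
  have h1 := vertexDist_triangle L 1 g (g * h)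
  have h2 := vertexDist_mul_left L g 1 h
  rw [mul_one] at h2
  omega

theorem vertexDist_one_inv (L : ℕ) (g : SnowflakeGroup L) :
    vertexDist L 1 g⁻¹ = vertexDist L 1 g := by
  have h := vertexDist_mul_left L g 1 g⁻¹
  rwa [mul_one, mul_inv_cancel, vertexDist_comm, eq_comm] at h

theorem vertexDist_one_gen_le (L : ℕ) (c : Gen) : vertexDist L 1 (gen L c) ≤ edgeLength L c := by
  simpa using vertexDist_edge L 1 c

theorem eval_nil (L : ℕ) : eval L [] = 1 := rfl

theorem eval_cons_true (L : ℕ) (c : Gen) (w : Word) :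
    eval L ((c, true) :: w) = gen L c * eval L w :=
  eval_append L [(c, true)] w

theorem eval_cons_false (L : ℕ) (c : Gen) (w : Word) :
    eval L ((c, false) :: w) = (gen L c)⁻¹ * eval L w := by
  have h := eval_append L [(c, false)] w
  rwa [show eval L [(c, false)] = (gen L c)⁻¹ from eval_invRev L [(c, true)]] at h

theorem wordLength_cons (L : ℕ) (l : Gen × Bool) (w : Word) :
    wordLength L (l :: w) = edgeLength L l.1 + wordLength L w := by
  simp [wordLength]

/-! ### The defining relations and homomorphisms out of the group -/

/-- A map on the generators that respects the defining relations extends to the group. -/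
theorem exists_hom {L : ℕ} {K : Type*} [Group K] (φ : Gen → K)
    (hs : φ .s * φ .a = φ .x * φ .s) (ht : φ .t * φ .a = φ .y * φ .t)
    (hL : φ .a ^ L = φ .x * φ .y) (hax : φ .a * φ .x = φ .x * φ .a)
    (hxy : φ .x * φ .y = φ .y * φ .x) (hya : φ .y * φ .a = φ .a * φ .y) :
    ∃ F : SnowflakeGroup L →* K, ∀ c, F (gen L c) = φ c := by
  refine ⟨PresentedGroup.toGroup (f := φ) ?_, fun c => PresentedGroup.toGroup.of _⟩
  intro r hr
  simp only [relators, Set.mem_insert_iff, Set.mem_singleton_iff] at hr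
  rcases hr with rfl | rfl | rfl | rfl | rfl | rfl <;>
    simp only [map_mul, map_inv, map_pow, FreeGroup.lift_apply_of]
  · rw [hs]; group
  · rw [ht]; group
  · rw [hL]; group
  · rw [hax]; group
  · rw [hxy]; group
  · rw [hya]; group

theorem relators_eq_one {L : ℕ} {r : FreeGroup Gen} (hr : r ∈ relators L) :
    PresentedGroup.mk (relators L) r = 1 := PresentedGroup.one_of_mem hr

/-- The generator `x` or `y` to which the stable letter `s` or `t` conjugates `a`. -/
def lineGen : Gen → Gen
  | .s => .x
  | .t => .y
  | c => c

theorem stable_mul_a (L : ℕ) {u : Gen} (hu : u = .s ∨ u = .t) :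
    gen L u * gen L .a = gen L (lineGen u) * gen L u := by
  rcases hu with rfl | rfl
  · have h : gen L .s * gen L .a * (gen L .s)⁻¹ * (gen L .x)⁻¹ = 1 :=
      relators_eq_one (L := L) (by simp [relators])
    rw [mul_inv_eq_one, mul_inv_eq_iff_eq_mul] at h
    exact h
  · have h : gen L .t * gen L .a * (gen L .t)⁻¹ * (gen L .y)⁻¹ = 1 :=
      relators_eq_one (L := L) (by simp [relators])
    rw [mul_inv_eq_one, mul_inv_eq_iff_eq_mul] at h
    exact h

theorem a_pow_eq (L : ℕ) : gen L .a ^ L = gen L .x * gen L .y := by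
  have h : gen L .a ^ L * (gen L .x * gen L .y)⁻¹ = 1 :=
    relators_eq_one (L := L) (by simp [relators])
  rwa [mul_inv_eq_one] at h

theorem commute_a_x (L : ℕ) : Commute (gen L .a) (gen L .x) := by
  have h : gen L .a * gen L .x * (gen L .a)⁻¹ * (gen L .x)⁻¹ = 1 :=
    relators_eq_one (L := L) (by simp [relators])
  rw [mul_inv_eq_one, mul_inv_eq_iff_eq_mul] at h
  exact h

theorem commute_x_y (L : ℕ) : Commute (gen L .x) (gen L .y) := by
  have h : gen L .x * gen L .y * (gen L .x)⁻¹ * (gen L .y)⁻¹ = 1 :=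
    relators_eq_one (L := L) (by simp [relators])
  rw [mul_inv_eq_one, mul_inv_eq_iff_eq_mul] at h
  exact h

theorem commute_a_y (L : ℕ) : Commute (gen L .a) (gen L .y) := by
  have h : gen L .y * gen L .a * (gen L .y)⁻¹ * (gen L .a)⁻¹ = 1 :=
    relators_eq_one (L := L) (by simp [relators])
  rw [mul_inv_eq_one, mul_inv_eq_iff_eq_mul] at h
  exact Eq.symm h

theorem stable_mul_a_zpow (L : ℕ) {u : Gen} (hu : u = .s ∨ u = .t) (k : ℤ) :
    gen L u * gen L .a ^ k = gen L (lineGen u) ^ k * gen L u :=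
  (SemiconjBy.zpow_right (show SemiconjBy _ _ _ from stable_mul_a L hu) k)

/-! ### The vertex group -/

/-- The element `a ^ i * x ^ j * y ^ k` of the vertex group `⟨a, x, y⟩`. -/
def flat (L : ℕ) (i j k : ℤ) : SnowflakeGroup L :=
  gen L .a ^ i * gen L .x ^ j * gen L .y ^ k

theorem flat_mul (L : ℕ) (i j k i' j' k' : ℤ) :
    flat L i j k * flat L i' j' k' = flat L (i + i') (j + j') (k + k') := by
  have h1 := ((commute_a_x L).zpow_zpow i' j).eq
  have h2 := ((commute_a_y L).zpow_zpow i' k).eq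
  have h3 := ((commute_x_y L).zpow_zpow j' k).eq
  simp only [flat, zpow_add]
  calc _ = gen L .a ^ i * gen L .x ^ j * (gen L .y ^ k * gen L .a ^ i') * gen L .x ^ j'
        * gen L .y ^ k' := by group
    _ = gen L .a ^ i * (gen L .x ^ j * gen L .a ^ i') * (gen L .y ^ k * gen L .x ^ j')
        * gen L .y ^ k' := by rw [← h2]; group
    _ = _ := by rw [← h1, ← h3]; group

theorem flat_zero (L : ℕ) : flat L 0 0 0 = 1 := by simp [flat]

theorem flat_inv (L : ℕ) (i j k : ℤ) : (flat L i j k)⁻¹ = flat L (-i) (-j) (-k) := by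
  rw [inv_eq_iff_mul_eq_one, flat_mul]
  simp [flat_zero]

theorem a_zpow_eq_flat (L : ℕ) (i : ℤ) : gen L .a ^ i = flat L i 0 0 := by simp [flat]

theorem x_zpow_eq_flat (L : ℕ) (i : ℤ) : gen L .x ^ i = flat L 0 i 0 := by simp [flat]

theorem y_zpow_eq_flat (L : ℕ) (i : ℤ) : gen L .y ^ i = flat L 0 0 i := by simp [flat]

theorem a_zpow_mul_eq (L : ℕ) (k : ℤ) : gen L .a ^ (L * k : ℤ) = gen L .x ^ k * gen L .y ^ k := by
  rw [zpow_mul, zpow_natCast, a_pow_eq, (commute_x_y L).mul_zpow]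

theorem translation_zpow {A : Type*} [AddCommGroup A] (v : A) (n : ℤ) (w : A) :
    ((Equiv.addRight v : Equiv.Perm A) ^ n) w = w + n • v := by
  induction n using Int.induction_on generalizing w with
  | zero => simp
  | succ n ih =>
    rw [zpow_add_one, Equiv.Perm.mul_apply, ih, Equiv.coe_addRight, add_zsmul, one_zsmul,
      add_assoc, add_comm v]
  | pred n ih =>
    rw [zpow_sub_one, Equiv.Perm.mul_apply, ih, show (Equiv.addRight v)⁻¹ w = w - v from
      (sub_eq_add_neg w v).symm, sub_zsmul, one_zsmul]
    abel

/-- The vertex group is free abelian: it acts faithfully on `ℤ × ℤ` by the translations by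
`a = (1, 0)`, `x = (0, 1)`, `y = (L, -1)`, and this action extends to the group, since
`s` and `t` can act by linear automorphisms that take `(1, 0)` to `(0, 1)` and to `(L, -1)`. -/
theorem flat_eq_one {L : ℕ} {i j k : ℤ} (h : flat L i j k = 1) : i + L * k = 0 ∧ j = k := by
  let φ : Gen → Equiv.Perm (ℤ × ℤ)
    | .a => Equiv.addRight (1, 0)
    | .x => Equiv.addRight (0, 1)
    | .y => Equiv.addRight ((L : ℤ), -1)
    | .s => Equiv.prodComm ℤ ℤ
    | .t => ⟨fun v => (L * v.1 + v.2, -v.1), fun v => (-v.2, v.1 + L * v.2),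
        fun v => by ext <;> simp, fun v => by ext <;> simp⟩
  obtain ⟨F, hF⟩ := exists_hom (L := L) φ
    (by ext v <;> simp [φ]) (by ext v <;> simp [φ] <;> ring)
    (by
      ext v : 1
      rw [← zpow_natCast, translation_zpow]
      ext <;> simp [φ]) (by ext v <;> simp [φ])
    (by ext v <;> simp [φ]) (by ext v <;> simp [φ] <;> ring)
  have h' := DFunLike.congr_fun (congrArg F h) ((0, 0) : ℤ × ℤ)
  simp only [flat, map_mul, map_zpow, hF, φ, Equiv.Perm.mul_apply, translation_zpow, map_one]
    at h'
  simp [Prod.ext_iff] at h'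
  constructor <;> linarith

/-! ### Branches of the Bass–Serre tree -/

/-- The exponent sum of a generator in the stable letters `s` and `t`. -/
def stableExponent : Gen → ℤ
  | .s => 1
  | .t => 1
  | _ => 0

theorem exists_height (L : ℕ) : ∃ F : SnowflakeGroup L →* Multiplicative ℤ,
    ∀ c, F (gen L c) = Multiplicative.ofAdd (stableExponent c) := by
  apply exists_hom <;> simp [stableExponent]

/-- The height: the exponent sum of an element in the stable letters. -/
noncomputable def height (L : ℕ) : SnowflakeGroup L →* Multiplicative ℤ := (exists_height L).choose

theorem height_gen (L : ℕ) (c : Gen) :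
    height L (gen L c) = Multiplicative.ofAdd (stableExponent c) := (exists_height L).choose_spec c

open scoped Classical in
/-- The permutation of the two sheets over the group by which a generator `c` acts: it multiplies
from the left and changes the sheet if `c` is the stable letter `u` and the result lies in `S`. -/
noncomputable def sheetPerm {G : Type*} [Group G] (S : Set G) (u c : Gen) (g : G) :
    Equiv.Perm (G × Bool) where
  toFun p := (g * p.1, xor p.2 (decide (c = u ∧ g * p.1 ∈ S)))
  invFun p := (g⁻¹ * p.1, xor p.2 (decide (c = u ∧ p.1 ∈ S)))
  left_inv p := by ext <;> simp
  right_inv p := by ext <;> simp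

/-- `B` is a branch at the stable letter `u`, with `X = u a u⁻¹`: the only edges of the Cayley
graph between `B` and its complement are those from `X ^ k` to `X ^ k u`, and these enter `B`.
In terms of the Bass–Serre tree, `B` is a half-space bounded by an edge. -/
structure IsBranch (L : ℕ) (u : Gen) (B : Set (SnowflakeGroup L)) : Prop where
  enter : ∀ k : ℤ, gen L (lineGen u) ^ k ∉ B ∧ gen L (lineGen u) ^ k * gen L u ∈ B
  stay : ∀ g c, ¬ (c = u ∧ g ∈ Subgroup.zpowers (gen L (lineGen u))) →
    (g * gen L c ∈ B ↔ g ∈ B)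

/-- Every stable letter has a branch: the number of crossings of the edges from `X ^ k` to
`X ^ k u` is even around each relator, so its parity is a function on the group. -/
theorem exists_isBranch (L : ℕ) {u : Gen} (hu : u = .s ∨ u = .t) : ∃ B, IsBranch L u B := by
  classical
  set X := gen L (lineGen u)
  let S : Set (SnowflakeGroup L) := Subgroup.zpowers X
  have hua : u ≠ .a := by rcases hu with rfl | rfl <;> simp
  have hux : u ≠ .x := by rcases hu with rfl | rfl <;> simp
  have huy : u ≠ .y := by rcases hu with rfl | rfl <;> simp
  let φ : Gen → Equiv.Perm (SnowflakeGroup L × Bool) := fun c => sheetPerm S u c (gen L c)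
  have hφ : ∀ c p, φ c p =
      (gen L c * p.1, xor p.2 (decide (c = u ∧ gen L c * p.1 ∈ S))) := fun _ _ => rfl
  have hφ' : ∀ c p, (φ c)⁻¹ p =
      ((gen L c)⁻¹ * p.1, xor p.2 (decide (c = u ∧ p.1 ∈ S))) := fun _ _ => rfl
  have hcomm : ∀ {c d : Gen}, c ≠ u → d ≠ u → Commute (gen L c) (gen L d) →
      φ c * φ d = φ d * φ c := by
    intro c d hc hd h
    ext p : 1
    simp [hφ, hc, hd, ← mul_assoc, h.eq]
  have hstable : ∀ {v : Gen}, (v = .s ∨ v = .t) → φ v * φ .a = φ (lineGen v) * φ v := by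
    intro v hv
    have hl : lineGen v ≠ u := by rcases hv with rfl | rfl <;> simp [lineGen, hux.symm, huy.symm]
    ext p : 1
    simp only [Equiv.Perm.mul_apply, hφ, hua.symm, hl, false_and, decide_false, Bool.xor_false,
      ← mul_assoc, stable_mul_a L hv, Prod.mk.injEq, true_and]
    by_cases huv : v = u
    · subst huv
      have : (X * gen L v * p.1 ∈ S) ↔ (gen L v * p.1 ∈ S) := by
        rw [mul_assoc]
        exact Subgroup.mul_mem_cancel_left _ (Subgroup.mem_zpowers X)
      simp [X, this] at this ⊢
    · simp [huv]
  have hpow : ∀ n : ℕ, ∀ p, (φ .a ^ n) p = (gen L .a ^ n * p.1, p.2) := by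
    intro n
    induction n with
    | zero => simp
    | succ n ih => intro p; simp [pow_succ', ih, hφ, hua.symm, mul_assoc]
  obtain ⟨F, hF⟩ := exists_hom (L := L) φ (hstable (Or.inl rfl)) (hstable (Or.inr rfl))
    (by ext p : 1; simp [hpow, hφ, hux.symm, huy.symm, a_pow_eq, mul_assoc])
    (hcomm hua.symm hux.symm (commute_a_x L)) (hcomm hux.symm huy.symm (commute_x_y L))
    (hcomm huy.symm hua.symm (commute_a_y L).symm)
  have hfst : ∀ g : SnowflakeGroup L, ∀ p, (F g p).1 = g * p.1 := by
    intro g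
    refine PresentedGroup.generated_by (relators L)
      { carrier := {g | ∀ p, (F g p).1 = g * p.1}
        mul_mem' := fun {g h} hg hh p => by
          simp only [Set.mem_ofPred_eq] at hg hh ⊢
          rw [map_mul, Equiv.Perm.mul_apply, hg, hh, mul_assoc]
        one_mem' := by simp
        inv_mem' := fun {g} hg p => by
          have h := hg (F g⁻¹ p)
          rw [← Equiv.Perm.mul_apply, ← map_mul, mul_inv_cancel, map_one] at h
          exact eq_inv_mul_of_mul_eq h.symm }
      (fun c p => by
        change (F (gen L c) p).1 = _
        rw [hF, hφ]) g
  -- The parity of the number of crossings on the way from `1` to `g`.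
  let b : SnowflakeGroup L → Bool := fun g => (F g⁻¹ (1, false)).2
  have hb : ∀ g c, b (g * gen L c) = xor (b g) (decide (c = u ∧ g ∈ S)) := by
    intro g c
    have h1 : (F g⁻¹ (1, false)).1 = g⁻¹ := by rw [hfst, mul_one]
    have h2 : (g⁻¹ ∈ S) ↔ g ∈ S := inv_mem_iff (H := Subgroup.zpowers X)
    simp only [b, mul_inv_rev, map_mul, map_inv F (gen L c), hF, Equiv.Perm.mul_apply, hφ', h1, h2]
  have hb1 : b 1 = false := by
    change (F 1⁻¹ (1, false)).2 = false
    rw [inv_one, map_one, Equiv.Perm.one_apply]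
  have hX : ∀ k : ℤ, b (X ^ k) = false := by
    have hl : lineGen u ≠ u := by rcases hu with rfl | rfl <;> simp [lineGen]
    have hstep : ∀ g, b (g * X) = b g := fun g => by simp [X, hb, hl]
    intro k
    induction k using Int.induction_on with
    | zero => simpa using hb1
    | succ n ih => rw [zpow_add_one, hstep, ih]
    | pred n ih => rw [← hstep, ← zpow_add_one, sub_add_cancel, ih]
  refine ⟨{g | b g = true}, ⟨fun k => ⟨by simp [X, hX k], ?_⟩, fun g c h => ?_⟩⟩
  · have : X ^ k ∈ S := Subgroup.zpow_mem_zpowers X k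
    simp [hb, X, hX k, this] at this ⊢
  · have h' : ¬ (c = u ∧ g ∈ S) := h
    simp [hb, h']

namespace IsBranch

variable {L : ℕ} {u : Gen} {B : Set (SnowflakeGroup L)}

theorem mem_stable (hB : IsBranch L u B) : gen L u ∈ B := by simpa using (hB.enter 0).2

theorem one_notMem (hB : IsBranch L u B) : (1 : SnowflakeGroup L) ∉ B := by
  simpa using (hB.enter 0).1

theorem mul_zpow_mem_iff (hB : IsBranch L u B) {c : Gen} (hc : c ≠ u) (g : SnowflakeGroup L)
    (k : ℤ) : g * gen L c ^ k ∈ B ↔ g ∈ B := by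
  have hstep : ∀ g, g * gen L c ∈ B ↔ g ∈ B := fun g => hB.stay g c fun h => hc h.1
  induction k using Int.induction_on with
  | zero => simp
  | succ n ih => rwa [zpow_add_one, ← mul_assoc, hstep]
  | pred n ih => rwa [← hstep, mul_assoc, ← zpow_add_one, sub_add_cancel]

theorem mul_flat_mem_iff (hB : IsBranch L u B) (hu : u = .s ∨ u = .t) (g : SnowflakeGroup L)
    (i j k : ℤ) : g * flat L i j k ∈ B ↔ g ∈ B := by
  have ha : Gen.a ≠ u := by rcases hu with rfl | rfl <;> simp
  have hx : Gen.x ≠ u := by rcases hu with rfl | rfl <;> simp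
  have hy : Gen.y ≠ u := by rcases hu with rfl | rfl <;> simp
  rw [flat, ← mul_assoc, ← mul_assoc, hB.mul_zpow_mem_iff hy, hB.mul_zpow_mem_iff hx,
    hB.mul_zpow_mem_iff ha]

/-- A path that leaves a branch runs through one of its bounding edges. -/
theorem exists_crossing_word (hB : IsBranch L u B) (hu : u = .s ∨ u = .t) (w : Word) :
    ∀ p, p ∈ B → p * eval L w ∉ B → ∃ k : ℤ,
      vertexDist L p (gen L (lineGen u) ^ k * gen L u) + 1 +
        vertexDist L (gen L (lineGen u) ^ k) (p * eval L w) ≤ wordLength L w := by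
  induction w with
  | nil =>
    intro p hp hq
    rw [eval_nil, mul_one] at hq
    exact absurd hp hq
  | cons l w ih =>
    intro p hp hq
    have main : ∀ p₁, p₁ * eval L w = p * eval L (l :: w) → p₁ ∈ B →
        vertexDist L p p₁ ≤ edgeLength L l.1 → ∃ k : ℤ,
        vertexDist L p (gen L (lineGen u) ^ k * gen L u) + 1 +
          vertexDist L (gen L (lineGen u) ^ k) (p * eval L (l :: w)) ≤
            wordLength L (l :: w) := by
      intro p₁ he hp₁ hd
      obtain ⟨k, hk⟩ := ih p₁ hp₁ (he ▸ hq)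
      refine ⟨k, ?_⟩
      rw [he] at hk
      have := vertexDist_triangle L p p₁ (gen L (lineGen u) ^ k * gen L u)
      rw [wordLength_cons]
      omega
    obtain ⟨c, ε⟩ := l
    cases ε with
    | true =>
      refine main (p * gen L c) (by rw [eval_cons_true, mul_assoc]) ?_ (vertexDist_edge L p c)
      by_contra hp₁
      by_cases h : c = u ∧ p ∈ Subgroup.zpowers (gen L (lineGen u))
      · obtain ⟨k, hk⟩ := Subgroup.mem_zpowers_iff.1 h.2
        exact (hB.enter k).1 (hk ▸ hp)
      · exact hp₁ ((hB.stay p c h).2 hp)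
    | false =>
      have hp' : p * (gen L c)⁻¹ * gen L c = p := inv_mul_cancel_right _ _
      have he : p * (gen L c)⁻¹ * eval L w = p * eval L ((c, false) :: w) := by
        rw [eval_cons_false, mul_assoc]
      by_cases hp₁ : p * (gen L c)⁻¹ ∈ B
      · refine main _ he hp₁ ?_
        have := vertexDist_edge L (p * (gen L c)⁻¹) c
        rwa [hp', vertexDist_comm] at this
      · by_cases h : c = u ∧ p * (gen L c)⁻¹ ∈ Subgroup.zpowers (gen L (lineGen u))
        · obtain ⟨k, hk⟩ := Subgroup.mem_zpowers_iff.1 h.2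
          obtain rfl := h.1
          refine ⟨k, ?_⟩
          rw [hk, hp', vertexDist_self, ← he, wordLength_cons]
          have h1 := vertexDist_le L (g := p * (gen L c)⁻¹) w rfl
          have h2 : edgeLength L c = 1 := by rcases hu with rfl | rfl <;> rfl
          simp only [h2]
          omega
        · have := hB.stay _ c h
          rw [hp'] at this
          exact absurd (this.1 hp) hp₁

/-- A geodesic that leaves a branch runs through one of its bounding edges. -/
theorem exists_crossing (hB : IsBranch L u B) (hu : u = .s ∨ u = .t) {p q : SnowflakeGroup L}
    (hp : p ∈ B) (hq : q ∉ B) : ∃ k : ℤ,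
      vertexDist L p (gen L (lineGen u) ^ k * gen L u) + 1 +
        vertexDist L (gen L (lineGen u) ^ k) q ≤ vertexDist L p q := by
  obtain ⟨w, rfl, hl⟩ := exists_geodesic L p q
  rw [← hl]
  exact hB.exists_crossing_word hu w p hp hq

end IsBranch

/-! ### Lengths in the vertex group -/

/-- The length of `a ^ k`. -/
noncomputable def aLen (L : ℕ) (k : ℤ) : ℕ := vertexDist L 1 (gen L .a ^ k)

/-- The length of the shortest word of the form `s w s⁻¹`, where `w` represents `a ^ k`, or zero
if `k = 0`: the cost of moving by `x ^ k` in the vertex group by an excursion to the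
neighbouring coset, and likewise for `t` and `y ^ k`. -/
noncomputable def excursionLen (L : ℕ) (k : ℤ) : ℕ := if k = 0 then 0 else aLen L k + 2

theorem aLen_zero (L : ℕ) : aLen L 0 = 0 := by simp [aLen, vertexDist_self]

theorem aLen_neg (L : ℕ) (k : ℤ) : aLen L (-k) = aLen L k := by
  rw [aLen, zpow_neg, vertexDist_one_inv, aLen]

theorem aLen_add_le (L : ℕ) (k l : ℤ) : aLen L (k + l) ≤ aLen L k + aLen L l := by
  rw [aLen, zpow_add]
  exact vertexDist_one_mul_le L _ _

theorem aLen_sub_le (L : ℕ) (k l : ℤ) : aLen L (k - l) ≤ aLen L k + aLen L l := by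
  rw [sub_eq_add_neg, ← aLen_neg L l]
  exact aLen_add_le L _ _

theorem aLen_one_le (L : ℕ) : aLen L 1 ≤ 1 := by
  simpa [aLen, edgeLength] using vertexDist_one_gen_le L .a

theorem aLen_natCast_le (L n : ℕ) : aLen L n ≤ n := by
  induction n with
  | zero => simp [aLen_zero]
  | succ n ih =>
    have h1 := aLen_add_le L n 1
    have h2 := aLen_one_le L
    push_cast
    omega

theorem aLen_le_natAbs (L : ℕ) (k : ℤ) : aLen L k ≤ k.natAbs := by
  rcases Int.natAbs_eq k with h | h
  · conv_lhs => rw [h]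
    exact aLen_natCast_le L _
  · conv_lhs => rw [h, aLen_neg]
    exact aLen_natCast_le L _

theorem aLen_le_excursionLen (L : ℕ) (k : ℤ) : aLen L k ≤ excursionLen L k := by
  unfold excursionLen
  split_ifs with h
  · simp [h, aLen_zero]
  · omega

theorem excursionLen_le (L : ℕ) (k : ℤ) : excursionLen L k ≤ aLen L k + 2 := by
  unfold excursionLen
  split_ifs <;> omega

theorem excursionLen_zero (L : ℕ) : excursionLen L 0 = 0 := if_pos rfl

theorem excursionLen_neg (L : ℕ) (k : ℤ) : excursionLen L (-k) = excursionLen L k := by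
  simp [excursionLen, aLen_neg]

theorem excursionLen_add_le (L : ℕ) (k l : ℤ) :
    excursionLen L (k + l) ≤ excursionLen L k + excursionLen L l := by
  by_cases hk : k = 0
  · simp [hk, excursionLen_zero]
  by_cases hl : l = 0
  · simp [hl, excursionLen_zero]
  have h1 := aLen_add_le L k l
  have h2 := excursionLen_le L (k + l)
  simp only [excursionLen, hk, hl, if_false] at h2 ⊢
  omega

/-- Up to a change of the exponents that does not change the element, `a ^ i * x ^ j * y ^ k` is
obtained from letters `a` and excursions that move along `x` and `y`, at total cost at most `n`. -/
def HasCost (L : ℕ) (i j k : ℤ) (n : ℕ) : Prop :=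
  ∃ p q r : ℤ, p + L * r = i + L * k ∧ q - r = j - k ∧
    p.natAbs + excursionLen L q + excursionLen L r ≤ n

theorem HasCost.self (L : ℕ) (i j k : ℤ) :
    HasCost L i j k (i.natAbs + excursionLen L j + excursionLen L k) :=
  ⟨i, j, k, rfl, rfl, le_rfl⟩

theorem HasCost.mono {L : ℕ} {i j k : ℤ} {m n : ℕ} (h : HasCost L i j k m) (hmn : m ≤ n) :
    HasCost L i j k n := by
  obtain ⟨p, q, r, h1, h2, h3⟩ := h
  exact ⟨p, q, r, h1, h2, h3.trans hmn⟩

theorem HasCost.add {L : ℕ} {i j k i' j' k' : ℤ} {m n : ℕ} (h : HasCost L i j k m)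
    (h' : HasCost L i' j' k' n) : HasCost L (i + i') (j + j') (k + k') (m + n) := by
  obtain ⟨p, q, r, h1, h2, h3⟩ := h
  obtain ⟨p', q', r', h1', h2', h3'⟩ := h'
  refine ⟨p + p', q + q', r + r', by linear_combination h1 + h1',
    by linear_combination h2 + h2', ?_⟩
  have e1 := Int.natAbs_add_le p p'
  have e2 := excursionLen_add_le L q q'
  have e3 := excursionLen_add_le L r r'
  omega

/-- The exponents for which `X ^ k = flat L 0 i j`, where `X = u a u⁻¹`. -/
theorem exists_line_flat (L : ℕ) {u : Gen} (hu : u = .s ∨ u = .t) (k : ℤ) :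
    ∃ i j : ℤ, gen L (lineGen u) ^ k = flat L 0 i j ∧ (i = k ∧ j = 0 ∨ i = 0 ∧ j = k) := by
  rcases hu with rfl | rfl
  · exact ⟨k, 0, x_zpow_eq_flat L k, by simp⟩
  · exact ⟨0, k, y_zpow_eq_flat L k, by simp⟩

/-- Excursions out of the vertex group through the stable letters `s⁻¹` and `t⁻¹`, which move
along `a`, are never needed: every element of the vertex group of length at most `n` is reached
at cost at most `n` by letters `a` and by excursions that move along `x` and `y`. -/
theorem hasCost_of_vertexDist_le {L : ℕ} (hL : 3 ≤ L) (n : ℕ) : ∀ i j k : ℤ,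
    vertexDist L 1 (flat L i j k) ≤ n → HasCost L i j k n := by
  induction n using Nat.strong_induction_on with
  | _ n ih =>
  intro i j k hn
  obtain ⟨w, hw, hl⟩ := exists_geodesic L 1 (flat L i j k)
  rw [one_mul] at hw
  -- A first step inside the vertex group.
  have inner : ∀ (i' j' k' : ℤ) (m : ℕ) (w' : Word), flat L i' j' k' * eval L w' = flat L i j k →
      HasCost L i' j' k' m → 0 < m → m + wordLength L w' ≤ n → HasCost L i j k n := by
    intro i' j' k' m w' hw' hc hm hle
    have he : eval L w' = flat L (-i' + i) (-j' + j) (-k' + k) := by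
      rw [← flat_mul, ← flat_inv, ← hw', inv_mul_cancel_left]
    have h1 : vertexDist L 1 (flat L (-i' + i) (-j' + j) (-k' + k)) ≤ wordLength L w' :=
      vertexDist_le L w' (by rw [one_mul, he])
    have h2 := hc.add (ih (wordLength L w') (by omega) _ _ _ h1)
    simp only [add_neg_cancel_left] at h2
    exact h2.mono hle
  have hone : excursionLen L 1 ≤ 3 := by
    have := aLen_one_le L
    have := excursionLen_le L 1
    omega
  -- A first step along the stable letter `u`: return along the excursion to the line of `u`.
  have outer : ∀ (u : Gen) (w' : Word), (u = .s ∨ u = .t) →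
      gen L u * eval L w' = flat L i j k → 1 + wordLength L w' ≤ n → HasCost L i j k n := by
    intro u w' hu hw' hle
    obtain ⟨B, hB⟩ := exists_isBranch L hu
    have hnot : gen L u * eval L w' ∉ B := by
      rw [hw', ← one_mul (flat L i j k), hB.mul_flat_mem_iff hu]
      exact hB.one_notMem
    obtain ⟨l, hl⟩ := hB.exists_crossing_word hu w' _ hB.mem_stable hnot
    obtain ⟨i', j', hX, hij⟩ := exists_line_flat L hu l
    have hd : vertexDist L (gen L u) (gen L u * gen L .a ^ l) = aLen L l := by
      conv_lhs => rw [← mul_one (gen L u), mul_assoc, vertexDist_mul_left, one_mul]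
      rfl
    rw [← stable_mul_a_zpow L hu, hw', hd, hX] at hl
    have h1 : vertexDist L (flat L 0 i' j') (flat L i j k) =
        vertexDist L 1 (flat L (-0 + i) (-i' + j) (-j' + k)) := by
      rw [← vertexDist_mul_left L (flat L 0 i' j')⁻¹, inv_mul_cancel, flat_inv, flat_mul]
    have h2 := ih _ (by omega) _ _ _ h1.ge
    have h3 := (HasCost.self L 0 i' j').add h2
    simp only [neg_zero, zero_add, add_neg_cancel_left] at h3
    refine h3.mono ?_
    have h4 := excursionLen_le L l
    have h5 : Int.natAbs 0 + excursionLen L i' + excursionLen L j' = excursionLen L l := by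
      rcases hij with ⟨rfl, rfl⟩ | ⟨rfl, rfl⟩ <;> simp [excursionLen_zero]
    omega
  -- A first step along `u⁻¹`: the excursion moves along `a`, and its cost bounds the length of
  -- the power of `a` by which it moves.
  have back : ∀ (u : Gen) (w' : Word), (u = .s ∨ u = .t) →
      (gen L u)⁻¹ * eval L w' = flat L i j k → 1 + wordLength L w' ≤ n → HasCost L i j k n := by
    intro u w' hu hw' hle
    obtain ⟨B, hB⟩ := exists_isBranch L hu
    rw [inv_mul_eq_iff_eq_mul] at hw'
    have hmem : gen L u * flat L i j k ∈ B := (hB.mul_flat_mem_iff hu _ _ _ _).2 hB.mem_stable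
    obtain ⟨l, hl⟩ := hB.exists_crossing hu hmem hB.one_notMem
    have hle' : vertexDist L (gen L u * flat L i j k) 1 ≤ wordLength L w' := by
      rw [vertexDist_comm]
      exact vertexDist_le L w' (by rw [one_mul, hw'])
    rw [← stable_mul_a_zpow L hu, vertexDist_mul_left, vertexDist_comm L _ 1] at hl
    obtain ⟨i', j', hX, hij⟩ := exists_line_flat L hu l
    rw [hX] at hl
    have hlen : aLen L l ≤ vertexDist L 1 (flat L 0 i' j') := by
      obtain ⟨p, q, r, h1, h2, h3⟩ :=
        ih _ (by omega) _ _ _ (le_refl (vertexDist L 1 (flat L 0 i' j')))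
      have h4 := aLen_le_excursionLen L q
      have h5 := aLen_le_excursionLen L r
      have h6 := aLen_sub_le L q r
      have h7 := aLen_neg L (q - r)
      rcases hij with ⟨rfl, rfl⟩ | ⟨rfl, rfl⟩
      · rw [show q - r = i' by linarith] at h6
        omega
      · rw [show -(q - r) = j' by linarith] at h7
        omega
    have h1 : vertexDist L (flat L i j k) (gen L .a ^ l) =
        vertexDist L 1 (flat L (-l + i) (-0 + j) (-0 + k)) := by
      rw [vertexDist_comm, ← vertexDist_mul_left L (gen L .a ^ l)⁻¹, inv_mul_cancel,
        a_zpow_eq_flat, flat_inv, flat_mul]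
    have h2 := ih _ (by omega) _ _ _ h1.ge
    have h3 := ih (aLen L l) (by omega) l 0 0 (by rw [← a_zpow_eq_flat, aLen])
    have h4 := h3.add h2
    simp only [add_neg_cancel_left] at h4
    exact h4.mono (by omega)
  have hletter : ∀ c : Gen, gen L c = gen L c ^ (1 : ℤ) := fun c => (zpow_one _).symm
  have hletter' : ∀ c : Gen, (gen L c)⁻¹ = gen L c ^ (-1 : ℤ) := fun c => (zpow_neg_one _).symm
  rcases w with _ | ⟨⟨c, ε⟩, w'⟩
  · obtain ⟨h1, h2⟩ := flat_eq_one hw.symm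
    exact ⟨0, 0, 0, by linarith, by linarith, by simp [excursionLen_zero]⟩
  rw [wordLength_cons] at hl
  cases ε with
  | true =>
    rw [eval_cons_true] at hw
    cases c with
    | a =>
      rw [hletter, a_zpow_eq_flat] at hw
      exact inner 1 0 0 1 w' hw ((HasCost.self L _ _ _).mono (by simp [excursionLen_zero]))
        one_pos (by simp only [edgeLength] at hl; omega)
    | x =>
      rw [hletter, x_zpow_eq_flat] at hw
      exact inner 0 1 0 L w' hw ((HasCost.self L _ _ _).mono (by simp [excursionLen_zero]; omega))
        (by omega) (by simp only [edgeLength] at hl; omega)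
    | y =>
      rw [hletter, y_zpow_eq_flat] at hw
      exact inner 0 0 1 L w' hw ((HasCost.self L _ _ _).mono (by simp [excursionLen_zero]; omega))
        (by omega) (by simp only [edgeLength] at hl; omega)
    | s => exact outer .s w' (Or.inl rfl) hw (by simp only [edgeLength] at hl; omega)
    | t => exact outer .t w' (Or.inr rfl) hw (by simp only [edgeLength] at hl; omega)
  | false =>
    have hone' : excursionLen L (-1) ≤ 3 := by rwa [excursionLen_neg]
    rw [eval_cons_false] at hw
    cases c with
    | a =>
      rw [hletter', a_zpow_eq_flat] at hw
      exact inner (-1) 0 0 1 w' hw ((HasCost.self L _ _ _).mono (by simp [excursionLen_zero]))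
        one_pos (by simp only [edgeLength] at hl; omega)
    | x =>
      rw [hletter', x_zpow_eq_flat] at hw
      exact inner 0 (-1) 0 L w' hw
        ((HasCost.self L _ _ _).mono (by simp [excursionLen_zero]; omega)) (by omega)
        (by simp only [edgeLength] at hl; omega)
    | y =>
      rw [hletter', y_zpow_eq_flat] at hw
      exact inner 0 0 (-1) L w' hw
        ((HasCost.self L _ _ _).mono (by simp [excursionLen_zero]; omega)) (by omega)
        (by simp only [edgeLength] at hl; omega)
    | s => exact back .s w' (Or.inl rfl) hw (by simp only [edgeLength] at hl; omega)
    | t => exact back .t w' (Or.inr rfl) hw (by simp only [edgeLength] at hl; omega)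

theorem excursionLen_add_excursionLen_le {L : ℕ} (hL : 6 ≤ L) (q r : ℤ) :
    excursionLen L q + excursionLen L r ≤ vertexDist L 1 (flat L 0 q r) := by
  obtain ⟨p', q', r', h1, h2, h3⟩ := hasCost_of_vertexDist_le (L := L) (by omega) _ 0 q r le_rfl
  refine le_trans ?_ h3
  -- The two descriptions differ by the relation `a ^ (L * e) = x ^ e * y ^ e`.
  obtain ⟨e, rfl⟩ : ∃ e, r' = r - e := ⟨r - r', by ring⟩
  obtain rfl : q' = q - e := by linarith
  obtain rfl : p' = L * e := by linear_combination h1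
  by_cases he : e = 0
  · simp [he]
  have k1 := excursionLen_le L q
  have k2 := excursionLen_le L r
  have k3 := aLen_add_le L e (q - e)
  have k4 := aLen_add_le L e (r - e)
  have k5 := aLen_le_natAbs L e
  have k6 := aLen_le_excursionLen L (q - e)
  have k7 := aLen_le_excursionLen L (r - e)
  rw [add_sub_cancel] at k3 k4
  have k8 : 6 * e.natAbs ≤ (L * e).natAbs := by
    rw [Int.natAbs_mul, Int.natAbs_natCast]
    exact Nat.mul_le_mul_right _ hL
  have k9 : 1 ≤ e.natAbs := Int.natAbs_pos.2 he
  omega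

/-- A geodesic word for `a ^ m` consists of letters `a` and of excursions that move along `x` and
`y` by the same exponent `r`. -/
theorem exists_aLen_decomposition {L : ℕ} (hL : 3 ≤ L) (m : ℤ) :
    ∃ p r : ℤ, m = p + L * r ∧ p.natAbs + 2 * excursionLen L r ≤ aLen L m := by
  obtain ⟨p, q, r, h1, h2, h3⟩ := hasCost_of_vertexDist_le hL (aLen L m) m 0 0
    (by rw [← a_zpow_eq_flat, aLen])
  obtain rfl : q = r := by linarith
  exact ⟨p, q, by linarith, by omega⟩

/-! ### The length of `a ^ (L ^ n)` -/

/-- A geodesic word for `a ^ m` has some depth `n` of nested excursions. The excursions account for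
`4 * (2 ^ n - 1)` stable letters, and the number of letters `a` satisfies two lower bounds. Each of
them is a subadditive function of `m` that is doubled when `m` is multiplied by `L` and `n` is
increased by one. The first bound serves for powers `m = L ^ N` with `N ≤ n`, the second for
`n < N`. -/
theorem exists_depth {L : ℕ} (hL : 6 ≤ L) (m : ℤ) : ∃ n : ℕ,
    4 * ((2 : ℝ) ^ n - 1) + |(m : ℝ)| ^ Real.logb L 2 ≤ aLen L m ∧
    4 * ((2 : ℝ) ^ n - 1) + |(m : ℝ)| * (2 / L) ^ n ≤ aLen L m := by
  have hL' : (6 : ℝ) ≤ L := by exact_mod_cast hL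
  have hL0 : (0 : ℝ) < L := by linarith
  have hβ0 : 0 < Real.logb L 2 := Real.logb_pos (by linarith) one_lt_two
  have hβ1 : Real.logb L 2 ≤ 1 := by
    rw [Real.logb_le_iff_le_rpow (by linarith) two_pos, Real.rpow_one]
    linarith
  have hrpow : ∀ p : ℤ, |(p : ℝ)| ^ Real.logb L 2 ≤ |(p : ℝ)| := by
    intro p
    rcases eq_or_ne p 0 with rfl | hp
    · simp [Real.zero_rpow hβ0.ne']
    · have : (1 : ℝ) ≤ |(p : ℝ)| := by exact_mod_cast Int.one_le_abs hp
      exact (Real.rpow_le_rpow_of_exponent_le this hβ1).trans_eq (Real.rpow_one _)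
  induction h : aLen L m using Nat.strong_induction_on generalizing m with
  | _ N ih =>
  subst h
  obtain ⟨p, r, hm, hpr⟩ := exists_aLen_decomposition (L := L) (by omega) m
  have hpabs : ((p.natAbs : ℕ) : ℝ) = |(p : ℝ)| := by
    rw [Nat.cast_natAbs, Int.cast_abs]
  by_cases hr : r = 0
  · obtain rfl : m = p := by simp [hm, hr]
    have h1 : |(m : ℝ)| ≤ aLen L m := by
      rw [← hpabs]
      exact_mod_cast (by omega : m.natAbs ≤ aLen L m)
    exact ⟨0, by simpa using (hrpow m).trans h1, by simpa using h1⟩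
  simp only [excursionLen, hr, if_false] at hpr
  obtain ⟨n, h1, h2⟩ := ih (aLen L r) (by omega) r rfl
  have hpr' : |(p : ℝ)| + 2 * ((aLen L r : ℝ) + 2) ≤ aLen L m := by
    rw [← hpabs]
    exact_mod_cast hpr
  have habs : |(m : ℝ)| ≤ |(p : ℝ)| + L * |(r : ℝ)| := by
    have := abs_add_le (p : ℝ) (L * r)
    rwa [abs_mul, Nat.abs_cast, ← Int.cast_natCast (R := ℝ) L, ← Int.cast_mul, ← Int.cast_add,
      ← hm, Int.cast_natCast] at this
  refine ⟨n + 1, ?_, ?_⟩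
  · have k1 : |(m : ℝ)| ^ Real.logb L 2 ≤ |(p : ℝ)| + 2 * |(r : ℝ)| ^ Real.logb L 2 := by
      refine (Real.rpow_le_rpow (abs_nonneg _) habs hβ0.le).trans ?_
      refine (Real.rpow_add_le_add_rpow (abs_nonneg _) (by positivity) hβ0.le hβ1).trans ?_
      rw [Real.mul_rpow hL0.le (abs_nonneg _), Real.rpow_logb hL0 (by linarith) two_pos]
      linarith [hrpow p]
    rw [pow_succ]
    linarith
  · have k1 : |(m : ℝ)| * (2 / L) ^ (n + 1) ≤ |(p : ℝ)| + 2 * (|(r : ℝ)| * (2 / L) ^ n) := by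
      have e1 : ((2 : ℝ) / L) ^ (n + 1) ≤ 1 :=
        pow_le_one₀ (by positivity) ((div_le_one hL0).2 (by linarith))
      have e2 : (0 : ℝ) ≤ (2 / L) ^ (n + 1) := by positivity
      have e3 : (L : ℝ) * |(r : ℝ)| * (2 / L) ^ (n + 1) = 2 * (|(r : ℝ)| * (2 / L) ^ n) := by
        rw [pow_succ]
        field_simp
      have e4 := mul_le_mul_of_nonneg_right habs e2
      have e5 := mul_le_mul_of_nonneg_left e1 (abs_nonneg (p : ℝ))
      linarith
    rw [pow_succ (2 : ℝ)]
    linarith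

theorem five_mul_two_pow_le_four_add_pow {L : ℕ} (hL : 6 ≤ L) (d : ℕ) :
    5 * 2 ^ (d + 1) ≤ 4 + L ^ (d + 1) := by
  induction d with
  | zero => simp; omega
  | succ d ih =>
    have h1 := Nat.mul_le_mul_left (L ^ (d + 1)) hL
    have h2 := Nat.one_le_two_pow (n := d + 1)
    rw [pow_succ, pow_succ L]
    omega

/-- The snowflake words are geodesic. -/
theorem five_mul_two_pow_le_aLen {L : ℕ} (hL : 6 ≤ L) (N : ℕ) :
    5 * 2 ^ N ≤ aLen L ((L : ℤ) ^ N) + 4 := by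
  have hL0 : (0 : ℝ) < L := by
    have : (6 : ℝ) ≤ L := by exact_mod_cast hL
    linarith
  have hL1 : (L : ℝ) ≠ 1 := by
    have : (6 : ℝ) ≤ L := by exact_mod_cast hL
    linarith
  obtain ⟨n, h1, h2⟩ := exists_depth hL ((L : ℤ) ^ N)
  push_cast at h1 h2
  rw [abs_of_pos (by positivity)] at h1 h2
  have goal : (5 : ℝ) * 2 ^ N ≤ aLen L ((L : ℤ) ^ N) + 4 := by
    rcases le_or_gt N n with h | h
    · rw [← Real.rpow_natCast (L : ℝ), ← Real.rpow_mul hL0.le, mul_comm (N : ℝ),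
        Real.rpow_mul hL0.le, Real.rpow_logb hL0 hL1 two_pos, Real.rpow_natCast] at h1
      have := pow_le_pow_right₀ (one_le_two (α := ℝ)) h
      linarith
    · obtain ⟨d, rfl⟩ := Nat.exists_eq_add_of_lt h
      have h3 : (5 : ℝ) * 2 ^ (d + 1) ≤ 4 + L ^ (d + 1) := by
        exact_mod_cast five_mul_two_pow_le_four_add_pow hL d
      have h4 : (L : ℝ) ^ (n + d + 1) * (2 / L) ^ n = 2 ^ n * L ^ (d + 1) := by
        rw [div_pow, add_assoc, pow_add]
        field_simp
      have h5 := mul_le_mul_of_nonneg_left h3 (pow_nonneg (zero_le_two (α := ℝ)) n)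
      rw [h4] at h2
      have h6 : (2 : ℝ) ^ (n + d + 1) = 2 ^ n * 2 ^ (d + 1) := by rw [add_assoc, pow_add]
      rw [h6]
      linarith
  exact_mod_cast goal

/-! ### Vertices along a word -/

/-- The `i`-th vertex of the edge path from `1` that reads `w`. -/
def prefixPoint (L : ℕ) (w : Word) (i : ℕ) : SnowflakeGroup L := eval L (w.take i)

theorem wordLength_eq_length {L : ℕ} {w : Word} (hw : ∀ l ∈ w, edgeLength L l.1 = 1) :
    wordLength L w = w.length := by
  rw [wordLength, List.sum_eq_card_nsmul _ 1 (List.forall_mem_map.2 hw)]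
  simp

theorem vertexDist_prefixPoint_le {L : ℕ} {w : Word} (hw : ∀ l ∈ w, edgeLength L l.1 = 1)
    {i j : ℕ} (hij : i ≤ j) : vertexDist L (prefixPoint L w i) (prefixPoint L w j) ≤ j - i := by
  have h : w.take j = w.take i ++ (w.drop i).take (j - i) := by
    rw [← List.take_add, Nat.add_sub_cancel' hij]
  have h1 := vertexDist_le L (g := prefixPoint L w i) (h := prefixPoint L w j)
    ((w.drop i).take (j - i)) (by rw [prefixPoint, prefixPoint, h, eval_append])
  rw [wordLength_eq_length fun l hl => hw l (List.mem_of_mem_drop (List.mem_of_mem_take hl))] at h1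
  exact h1.trans (List.length_take_le _ _)

/-! ### The sides of the snowflake loops -/

/-- The two stable letters in one of the two orders. -/
def StablePair (u v : Gen) : Prop := u = .s ∧ v = .t ∨ u = .t ∧ v = .s

theorem StablePair.symm {u v : Gen} (h : StablePair u v) : StablePair v u :=
  Or.symm (Or.imp And.symm And.symm h)

theorem StablePair.left {u v : Gen} (h : StablePair u v) : u = .s ∨ u = .t :=
  h.imp And.left And.left

/-- The length `5 * 2 ^ n - 4` of a side of the `n`-th snowflake loop. -/
def sideLength (n : ℕ) : ℕ := 5 * 2 ^ n - 4

theorem sideLength_succ (n : ℕ) : sideLength (n + 1) = 2 * sideLength n + 4 := by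
  have := Nat.one_le_two_pow (n := n)
  simp only [sideLength, pow_succ]
  omega

theorem edgeLength_stable (L : ℕ) {u : Gen} (hu : u = .s ∨ u = .t) : edgeLength L u = 1 := by
  rcases hu with rfl | rfl <;> rfl

theorem edgeLength_of_mem_snowflakeWord (L : ℕ) {u v : Gen} (h : StablePair u v) (n : ℕ) :
    ∀ l ∈ snowflakeWord u v n, edgeLength L l.1 = 1 := by
  have hu := edgeLength_stable L h.left
  have hv := edgeLength_stable L h.symm.left
  induction n with
  | zero => simp [snowflakeWord, edgeLength]
  | succ n ih =>
    intro l hl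
    simp only [snowflakeWord, List.mem_append, List.mem_singleton] at hl
    rcases hl with ((((rfl | hl) | rfl) | rfl) | hl) | rfl
    · exact hu
    · exact ih l hl
    · exact hu
    · exact hv
    · exact ih l hl
    · exact hv

theorem length_snowflakeWord (u v : Gen) (n : ℕ) : (snowflakeWord u v n).length = sideLength n := by
  induction n with
  | zero => rfl
  | succ n ih =>
    rw [sideLength_succ]
    simp only [snowflakeWord, List.length_append, List.length_singleton, ih]
    omega

theorem line_mul_line (L : ℕ) {u v : Gen} (h : StablePair u v) (k : ℤ) :
    gen L (lineGen u) ^ k * gen L (lineGen v) ^ k = gen L .a ^ (L * k : ℤ) := by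
  rw [a_zpow_mul_eq]
  rcases h with ⟨rfl, rfl⟩ | ⟨rfl, rfl⟩
  · rfl
  · exact ((commute_x_y L).zpow_zpow k k).eq.symm

theorem eval_excursion (L : ℕ) {u : Gen} (hu : u = .s ∨ u = .t) {w : Word} {k : ℤ}
    (hw : eval L w = gen L .a ^ k) :
    eval L ([(u, true)] ++ w ++ [(u, false)]) = gen L (lineGen u) ^ k := by
  rw [eval_append, eval_append, eval_cons_true, eval_cons_false, eval_nil, hw, mul_one, mul_one,
    stable_mul_a_zpow L hu, mul_inv_cancel_right]

theorem eval_snowflakeWord (L : ℕ) {u v : Gen} (h : StablePair u v) (n : ℕ) :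
    eval L (snowflakeWord u v n) = gen L .a ^ ((L : ℤ) ^ n) := by
  induction n with
  | zero => simp [snowflakeWord, eval_cons_true, eval_nil]
  | succ n ih =>
    have hw : snowflakeWord u v (n + 1) = ([(u, true)] ++ snowflakeWord u v n ++ [(u, false)]) ++
        ([(v, true)] ++ snowflakeWord u v n ++ [(v, false)]) := by simp [snowflakeWord]
    rw [hw, eval_append, eval_excursion L h.left ih, eval_excursion L h.symm.left ih,
      line_mul_line L h, pow_succ']

/-- The `i`-th vertex of the side of the `n`-th snowflake loop that starts with the letter `u`. -/
def sidePoint (L : ℕ) (u v : Gen) (n i : ℕ) : SnowflakeGroup L :=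
  prefixPoint L (snowflakeWord u v n) i

theorem sidePoint_zero (L n : ℕ) (u v : Gen) : sidePoint L u v n 0 = 1 := by
  simp [sidePoint, prefixPoint, eval_nil]

theorem sidePoint_end (L : ℕ) {u v : Gen} (h : StablePair u v) (n : ℕ) :
    sidePoint L u v n (sideLength n) = gen L .a ^ ((L : ℤ) ^ n) := by
  rw [← eval_snowflakeWord L h, sidePoint, prefixPoint, ← length_snowflakeWord u v,
    List.take_length]

theorem sidePoint_left (L n : ℕ) (u v : Gen) {i : ℕ} (hi : i ≤ sideLength n) :
    sidePoint L u v (n + 1) (i + 1) = gen L u * sidePoint L u v n i := by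
  have hw : snowflakeWord u v (n + 1) =
      (u, true) :: (snowflakeWord u v n ++ ([(u, false)] ++
        [(v, true)] ++ snowflakeWord u v n ++ [(v, false)])) := by simp [snowflakeWord]
  rw [sidePoint, prefixPoint, hw, List.take_succ_cons,
    List.take_append_of_le_length (by rwa [length_snowflakeWord]), eval_cons_true]
  rfl

theorem sidePoint_middle (L : ℕ) {u v : Gen} (h : StablePair u v) (n : ℕ) :
    sidePoint L u v (n + 1) (sideLength n + 2) = gen L (lineGen u) ^ ((L : ℤ) ^ n) := by
  have hw : snowflakeWord u v (n + 1) = ([(u, true)] ++ snowflakeWord u v n ++ [(u, false)]) ++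
      ([(v, true)] ++ snowflakeWord u v n ++ [(v, false)]) := by simp [snowflakeWord]
  have hl : ([(u, true)] ++ snowflakeWord u v n ++ [(u, false)]).length = sideLength n + 2 := by
    simp [length_snowflakeWord]
  rw [sidePoint, prefixPoint, hw, ← hl, List.take_left,
    eval_excursion L h.left (eval_snowflakeWord L h n)]

theorem sidePoint_right (L : ℕ) {u v : Gen} (h : StablePair u v) (n : ℕ) {i : ℕ}
    (hi : i ≤ sideLength n) :
    sidePoint L u v (n + 1) (sideLength n + 2 + (i + 1)) =
      gen L (lineGen u) ^ ((L : ℤ) ^ n) * gen L v * sidePoint L u v n i := by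
  have hw : snowflakeWord u v (n + 1) = ([(u, true)] ++ snowflakeWord u v n ++ [(u, false)]) ++
      ((v, true) :: (snowflakeWord u v n ++ [(v, false)])) := by simp [snowflakeWord]
  have hl : ([(u, true)] ++ snowflakeWord u v n ++ [(u, false)]).length = sideLength n + 2 := by
    simp [length_snowflakeWord]
  rw [sidePoint, prefixPoint, hw, ← hl, List.take_length_add_append, eval_append,
    eval_excursion L h.left (eval_snowflakeWord L h n), List.take_succ_cons,
    List.take_append_of_le_length (by rwa [length_snowflakeWord]), eval_cons_true, ← mul_assoc]
  rfl

theorem sidePoint_cases {n i : ℕ} (hi : i ≤ sideLength (n + 1)) :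
    i = 0 ∨ (∃ j ≤ sideLength n, i = j + 1) ∨ i = sideLength n + 2 ∨
      (∃ j ≤ sideLength n, i = sideLength n + 2 + (j + 1)) ∨ i = sideLength (n + 1) := by
  have h := sideLength_succ n
  rcases Nat.lt_trichotomy i (sideLength n + 2) with h1 | h1 | h1
  · rcases i with _ | j
    · exact Or.inl rfl
    · exact Or.inr (Or.inl ⟨j, by omega, rfl⟩)
  · exact Or.inr (Or.inr (Or.inl h1))
  · rcases hi.eq_or_lt with h2 | h2
    · exact Or.inr (Or.inr (Or.inr (Or.inr h2)))
    · exact Or.inr (Or.inr (Or.inr (Or.inl ⟨i - (sideLength n + 2) - 1, by omega, by omega⟩)))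

/-- The sides of the snowflake loops are geodesic. -/
theorem sub_le_vertexDist_sidePoint {L : ℕ} {u v : Gen} (h : StablePair u v) (hL : 6 ≤ L)
    {n i j : ℕ} (hj : j ≤ sideLength n) :
    j - i ≤ vertexDist L (sidePoint L u v n i) (sidePoint L u v n j) := by
  rcases le_total j i with hij | hij
  · omega
  have h0 := five_mul_two_pow_le_aLen hL n
  have h1 := vertexDist_prefixPoint_le (edgeLength_of_mem_snowflakeWord L h n) (Nat.zero_le i)
  have h2 := vertexDist_prefixPoint_le (edgeLength_of_mem_snowflakeWord L h n) hj
  have h3 := vertexDist_triangle L 1 (sidePoint L u v n i) (sidePoint L u v n j)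
  have h4 := vertexDist_triangle L 1 (sidePoint L u v n j) (sidePoint L u v n (sideLength n))
  change vertexDist L (sidePoint L u v n 0) (sidePoint L u v n i) ≤ _ at h1
  change vertexDist L (sidePoint L u v n j) (sidePoint L u v n (sideLength n)) ≤ _ at h2
  rw [sidePoint_zero] at h1
  rw [sidePoint_end L h] at h2 h4
  rw [aLen] at h0
  unfold sideLength at *
  omega

/-- The sides of the snowflake loops only move upwards from their starting point, so their
translates to height at least one do not cross the boundary of a branch, which is at height
between zero and one. -/
theorem IsBranch.mul_sidePoint_mem_iff {L : ℕ} {u : Gen} {B : Set (SnowflakeGroup L)}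
    (hB : IsBranch L u B) (hu : u = .s ∨ u = .t) {v w : Gen} (h : StablePair v w) (n : ℕ) :
    ∀ (g : SnowflakeGroup L) (i : ℕ), 0 < (height L g).toAdd → i ≤ sideLength n →
      (g * sidePoint L v w n i ∈ B ↔ g ∈ B) := by
  have hline : ∀ v, (v = .s ∨ v = .t) → ∀ k : ℤ, height L (gen L (lineGen v) ^ k) = 1 := by
    rintro v (rfl | rfl) k <;> simp [height_gen, lineGen, stableExponent]
  have hflat : ∀ v, (v = .s ∨ v = .t) → ∀ g, ∀ k : ℤ, g * gen L (lineGen v) ^ k ∈ B ↔ g ∈ B := by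
    intro v hv g k
    obtain ⟨i, j, h, -⟩ := exists_line_flat L hv k
    rw [h, hB.mul_flat_mem_iff hu]
  have hstep : ∀ g c, 0 < (height L g).toAdd → (g * gen L c ∈ B ↔ g ∈ B) := by
    intro g c hg
    refine hB.stay g c fun hc => ?_
    obtain ⟨k, rfl⟩ := Subgroup.mem_zpowers_iff.1 hc.2
    rw [hline u hu] at hg
    exact lt_irrefl _ hg
  have hup : ∀ g v, (v = .s ∨ v = .t) → 0 < (height L g).toAdd →
      0 < (height L (g * gen L v)).toAdd := by
    intro g v hv hg
    have : stableExponent v = 1 := by rcases hv with rfl | rfl <;> rfl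
    rw [map_mul, height_gen, toAdd_mul, this, toAdd_ofAdd]
    omega
  have hend : ∀ n g, g * sidePoint L v w n (sideLength n) ∈ B ↔ g ∈ B := by
    intro n g
    rw [sidePoint_end L h, a_zpow_eq_flat, hB.mul_flat_mem_iff hu]
  induction n with
  | zero =>
    intro g i hg hi
    rcases (show i = 0 ∨ i = sideLength 0 by unfold sideLength at *; omega) with rfl | rfl
    · rw [sidePoint_zero, mul_one]
    · exact hend 0 g
  | succ n ih =>
    intro g i hg hi
    rcases sidePoint_cases hi with rfl | ⟨j, hj, rfl⟩ | rfl | ⟨j, hj, rfl⟩ | rfl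
    · rw [sidePoint_zero, mul_one]
    · rw [sidePoint_left L n v w hj, ← mul_assoc, ih _ _ (hup g v h.left hg) hj, hstep g v hg]
    · rw [sidePoint_middle L h, hflat v h.left]
    · have hg' : 0 < (height L (g * gen L (lineGen v) ^ (L : ℤ) ^ n)).toAdd := by
        rwa [map_mul, hline v h.left, mul_one]
      rw [sidePoint_right L h n hj, ← mul_assoc, ← mul_assoc, ih _ _ (hup _ w h.symm.left hg') hj,
        hstep _ w hg', hflat v h.left]
    · exact hend _ g

theorem exists_line_mul_line_flat {L : ℕ} {u v : Gen} (h : StablePair u v) (k l : ℤ) :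
    ∃ i j : ℤ, gen L (lineGen u) ^ k * gen L (lineGen v) ^ l = flat L 0 i j ∧
      excursionLen L i + excursionLen L j = excursionLen L k + excursionLen L l := by
  rcases h with ⟨rfl, rfl⟩ | ⟨rfl, rfl⟩
  · exact ⟨k, l, by simp [flat, lineGen], rfl⟩
  · exact ⟨l, k, by simp [flat, lineGen, ((commute_x_y L).zpow_zpow l k).eq], add_comm _ _⟩

theorem excursionLen_add_le_line {L : ℕ} (hL : 6 ≤ L) {u v : Gen} (h : StablePair u v) (k l : ℤ) :
    excursionLen L k + excursionLen L l ≤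
      vertexDist L 1 (gen L (lineGen u) ^ k * gen L (lineGen v) ^ l) := by
  obtain ⟨i, j, h1, h2⟩ := exists_line_mul_line_flat (L := L) h k l
  rw [h1, ← h2]
  exact excursionLen_add_excursionLen_le hL i j

/-- The induction step for opposite branches: a geodesic between points of the branches over two
opposite sides of the parallelogram with sides `X ^ (L ^ n)` and `Y ^ (L ^ n)` runs through the
lines under these branches, and the distance between the lines is attained by moving along `Y`
only, so the two branches may be identified at the expense of the length of `Y ^ (L ^ n)`. -/
theorem vertexDist_add_le_opposite {L : ℕ} {u v : Gen} (h : StablePair u v) (hL : 6 ≤ L)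
    {n i j : ℕ} (hi : i ≤ sideLength n) (hj : j ≤ sideLength n) :
    vertexDist L (sidePoint L u v n i) (sidePoint L v u n j) + sideLength n + 4 ≤
      vertexDist L (gen L u * sidePoint L u v n i)
        (gen L (lineGen v) ^ ((L : ℤ) ^ n) * gen L u * sidePoint L v u n j) := by
  set P := sidePoint L u v n i
  set Q := sidePoint L v u n j
  set M : ℤ := (L : ℤ) ^ n
  set X := gen L (lineGen u)
  set Y := gen L (lineGen v)
  have hM : M ≠ 0 := pow_ne_zero _ (by omega)
  obtain ⟨B, hB⟩ := exists_isBranch L h.left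
  have hhu : 0 < (height L (gen L u)).toAdd := by
    rcases h.left with rfl | rfl <;> simp [height_gen, stableExponent]
  have hhY : height L (Y ^ M) = 1 := by
    rcases h.symm.left with rfl | rfl <;> simp [Y, height_gen, lineGen, stableExponent]
  have hflat : ∀ k l : ℤ, X ^ k * Y ^ l ∉ B := by
    intro k l
    obtain ⟨i, j, hij, -⟩ := exists_line_mul_line_flat (L := L) h k l
    rw [hij, ← one_mul (flat L 0 i j), hB.mul_flat_mem_iff h.left]
    exact hB.one_notMem
  have hP : gen L u * P ∈ B := (hB.mul_sidePoint_mem_iff h.left h n _ _ hhu hi).2 hB.mem_stable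
  have hQ : gen L u * Q ∈ B :=
    (hB.mul_sidePoint_mem_iff h.left h.symm n _ _ hhu hj).2 hB.mem_stable
  have hYM : Y ^ M ∉ B := by simpa using hflat 0 M
  have hcomm : ∀ k l : ℤ, Y ^ l * X ^ k = X ^ k * Y ^ l := by
    intro k l
    have hc : Commute X Y := by
      rcases h with ⟨rfl, rfl⟩ | ⟨rfl, rfl⟩
      · exact commute_x_y L
      · exact (commute_x_y L).symm
    exact (hc.zpow_zpow k l).eq.symm
  have hQ' : Y ^ M * gen L u * Q ∉ B := by
    have hhu' : 0 < (height L (Y ^ M * gen L u)).toAdd := by rwa [map_mul, hhY, one_mul]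
    rw [hB.mul_sidePoint_mem_iff h.left h.symm n _ _ hhu' hj, hB.stay]
    · exact hYM
    · rintro ⟨-, hmem⟩
      obtain ⟨k, hk⟩ := Subgroup.mem_zpowers_iff.1 hmem
      have h1 : X ^ (-k) * Y ^ M = 1 := by
        rw [zpow_neg, inv_mul_eq_one]
        exact hk
      obtain ⟨i', j', h2, h3⟩ := exists_line_mul_line_flat (L := L) h (-k) M
      obtain ⟨h4, h5⟩ := flat_eq_one (h2.symm.trans h1)
      obtain rfl : j' = 0 := by
        simpa [show L ≠ 0 by omega] using h4
      subst h5
      simp [excursionLen, hM] at h3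
  obtain ⟨k, hk⟩ := hB.exists_crossing h.left hP hQ'
  have hXY : Y ^ (-M) * X ^ k ∉ B := hcomm k (-M) ▸ hflat k (-M)
  obtain ⟨l, hl⟩ := hB.exists_crossing h.left hQ hXY
  have hd : vertexDist L (X ^ k) (Y ^ M * gen L u * Q) =
      vertexDist L (gen L u * Q) (Y ^ (-M) * X ^ k) := by
    rw [vertexDist_comm, ← vertexDist_mul_left L (Y ^ M)⁻¹, mul_assoc, inv_mul_cancel_left,
      zpow_neg]
  rw [← stable_mul_a_zpow L h.left, vertexDist_mul_left] at hk hl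
  change _ + 1 + vertexDist L (X ^ k) _ ≤ _ at hk
  change _ + 1 + vertexDist L (X ^ l) _ ≤ _ at hl
  have hlen : vertexDist L (X ^ l) (Y ^ (-M) * X ^ k) =
      vertexDist L 1 (X ^ (k - l) * Y ^ (-M)) := by
    rw [← vertexDist_mul_left L (X ^ (-l)), hcomm, ← mul_assoc, ← zpow_add, ← zpow_add]
    simp [sub_eq_neg_add]
  have h1 : _ ≤ vertexDist L 1 (X ^ (k - l) * Y ^ (-M)) :=
    excursionLen_add_le_line hL h (k - l) (-M)
  have h2 := aLen_le_excursionLen L (k - l)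
  have h3 : excursionLen L (-M) = aLen L M + 2 := by
    rw [excursionLen_neg, excursionLen, if_neg hM]
  have h4 : 5 * 2 ^ n ≤ aLen L M + 4 := five_mul_two_pow_le_aLen hL n
  have h5 : vertexDist L (gen L .a ^ l) (gen L .a ^ k) = aLen L (k - l) := by
    rw [← vertexDist_mul_left L (gen L .a ^ (-l)), ← zpow_add, ← zpow_add, aLen]
    simp [sub_eq_neg_add]
  have h6 := vertexDist_triangle L P (gen L .a ^ k) Q
  have h7 := vertexDist_triangle L (gen L .a ^ k) (gen L .a ^ l) Q
  rw [vertexDist_comm L (gen L .a ^ k) (gen L .a ^ l), h5,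
    vertexDist_comm L (gen L .a ^ l) Q] at h7
  have h8 : sideLength n ≤ aLen L M := by unfold sideLength; omega
  omega

/-- The distance between points on different sides of a snowflake loop is at least (and hence
equal to) their distance along the loop. -/
theorem le_vertexDist_sides {L : ℕ} (hL : 6 ≤ L) (n : ℕ) :
    ∀ {u v : Gen}, StablePair u v → ∀ {i j : ℕ}, i ≤ sideLength n → j ≤ sideLength n →
    i + j ≤ vertexDist L (sidePoint L u v n i) (sidePoint L v u n j) ∨
      2 * sideLength n ≤ vertexDist L (sidePoint L u v n i) (sidePoint L v u n j) + (i + j) := by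
  have hstart : ∀ n {u v : Gen}, StablePair u v → ∀ j ≤ sideLength n,
      j ≤ vertexDist L (sidePoint L u v n 0) (sidePoint L v u n j) := by
    intro n u v h j hj
    rw [sidePoint_zero, ← sidePoint_zero L n v u]
    simpa only [Nat.sub_zero] using sub_le_vertexDist_sidePoint h.symm hL (i := 0) hj
  have hend : ∀ n {u v : Gen}, StablePair u v → ∀ i, sideLength n - i ≤
      vertexDist L (sidePoint L u v n i) (sidePoint L v u n (sideLength n)) := by
    intro n u v h i
    rw [sidePoint_end L h.symm, ← sidePoint_end L h]
    exact sub_le_vertexDist_sidePoint h hL le_rfl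
  induction n with
  | zero =>
    intro u v h i j hi hj
    have h1 := hstart 0 h j hj
    have h2 := hend 0 h i
    have h3 : sideLength 0 = 1 := rfl
    rcases (show i = 0 ∨ i = 1 by omega) with rfl | rfl
    · exact Or.inl (by omega)
    rcases (show j = 0 ∨ j = 1 by omega) with rfl | rfl
    · have := hstart 0 h.symm 1 hi
      rw [vertexDist_comm] at this
      exact Or.inl this
    · exact Or.inr (by omega)
  | succ n ih =>
    have hopp : ∀ {u v : Gen}, StablePair u v → ∀ {i j : ℕ}, i < sideLength n + 2 →
        sideLength n + 2 < j → j ≤ sideLength (n + 1) →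
        i + j ≤ vertexDist L (sidePoint L u v (n + 1) i) (sidePoint L v u (n + 1) j) ∨
        2 * sideLength (n + 1) ≤
          vertexDist L (sidePoint L u v (n + 1) i) (sidePoint L v u (n + 1) j) + (i + j) := by
      intro u v h i j hi hj hj'
      have hs := sideLength_succ n
      rcases i with _ | i
      · have := hstart (n + 1) h j hj'
        omega
      obtain ⟨j, rfl⟩ : ∃ j', j = sideLength n + 2 + (j' + 1) :=
        ⟨j - (sideLength n + 2) - 1, by omega⟩
      rcases hj'.eq_or_lt with hj' | hj'
      · have := hend (n + 1) h (i + 1)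
        rw [hj']
        omega
      have h1 := vertexDist_add_le_opposite h hL (show i ≤ sideLength n by omega)
        (show j ≤ sideLength n by omega)
      have h2 := ih h (show i ≤ sideLength n by omega) (show j ≤ sideLength n by omega)
      rw [sidePoint_left L n u v (by omega), sidePoint_right L h.symm n (by omega)]
      omega
    intro u v h i j hi hj
    have hs := sideLength_succ n
    have hmid : 2 * (sideLength n + 2) ≤ vertexDist L (sidePoint L u v (n + 1) (sideLength n + 2))
        (sidePoint L v u (n + 1) (sideLength n + 2)) := by
      have hM : (L : ℤ) ^ n ≠ 0 := pow_ne_zero _ (by omega)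
      have h1 := excursionLen_add_le_line hL h (-(L : ℤ) ^ n) ((L : ℤ) ^ n)
      have h2 := five_mul_two_pow_le_aLen hL n
      rw [excursionLen_neg, excursionLen, if_neg hM] at h1
      rw [sidePoint_middle L h, sidePoint_middle L h.symm,
        ← vertexDist_mul_left L (gen L (lineGen u) ^ (-(L : ℤ) ^ n)), ← zpow_add, neg_add_cancel,
        zpow_zero]
      have h3 : sideLength n ≤ aLen L ((L : ℤ) ^ n) := by unfold sideLength; omega
      omega
    have hwu := edgeLength_of_mem_snowflakeWord L h (n + 1)
    have hwv := edgeLength_of_mem_snowflakeWord L h.symm (n + 1)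
    have t1 := vertexDist_triangle L (sidePoint L u v (n + 1) (sideLength n + 2))
      (sidePoint L u v (n + 1) i) (sidePoint L v u (n + 1) (sideLength n + 2))
    have t2 := vertexDist_triangle L (sidePoint L u v (n + 1) i)
      (sidePoint L v u (n + 1) j) (sidePoint L v u (n + 1) (sideLength n + 2))
    rcases le_or_gt i (sideLength n + 2) with hi' | hi' <;>
    rcases le_or_gt j (sideLength n + 2) with hj' | hj'
    · have h1 := vertexDist_prefixPoint_le hwu hi'
      have h2 := vertexDist_prefixPoint_le hwv hj'
      rw [vertexDist_comm] at h1
      simp only [sidePoint] at *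
      omega
    · rcases hi'.eq_or_lt with rfl | hi'
      · have h2 := vertexDist_prefixPoint_le hwv hj'.le
        rw [vertexDist_comm] at h2
        simp only [sidePoint] at *
        omega
      · exact hopp h hi' hj' hj
    · rcases hj'.eq_or_lt with rfl | hj'
      · have h1 := vertexDist_prefixPoint_le hwu hi'.le
        simp only [sidePoint] at *
        omega
      · have := hopp h.symm hj' hi' hi
        rw [vertexDist_comm] at this
        omega
    · have h1 := vertexDist_prefixPoint_le hwu hi'.le
      have h2 := vertexDist_prefixPoint_le hwv hj'.le
      rw [vertexDist_comm] at h2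
      simp only [sidePoint] at *
      omega

/-! ### The vertices of the snowflake loops -/

theorem stablePair_st : StablePair .s .t := Or.inl ⟨rfl, rfl⟩

theorem length_snowflakeLoopWord (n : ℕ) :
    (snowflakeLoopWord n).length = 2 * sideLength n := by
  simp [snowflakeLoopWord, FreeGroup.invRev, length_snowflakeWord, two_mul]

theorem edgeLength_of_mem_snowflakeLoopWord (L n : ℕ) :
    ∀ l ∈ snowflakeLoopWord n, edgeLength L l.1 = 1 := by
  intro l hl
  rw [snowflakeLoopWord, List.mem_append] at hl
  rcases hl with hl | hl
  · exact edgeLength_of_mem_snowflakeWord L stablePair_st n l hl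
  · simp only [FreeGroup.invRev, List.mem_reverse, List.mem_map] at hl
    obtain ⟨l', hl', rfl⟩ := hl
    exact edgeLength_of_mem_snowflakeWord L stablePair_st.symm n l' hl'

theorem take_invRev (w : Word) (k : ℕ) :
    (FreeGroup.invRev w).take k = FreeGroup.invRev (w.drop (w.length - k)) := by
  simp [FreeGroup.invRev, List.take_reverse]

theorem loopPoint_first (L : ℕ) {n i : ℕ} (hi : i ≤ sideLength n) :
    prefixPoint L (snowflakeLoopWord n) i = sidePoint L .s .t n i := by
  rw [prefixPoint, snowflakeLoopWord,
    List.take_append_of_le_length (by rwa [length_snowflakeWord])]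
  rfl

theorem loopPoint_second (L : ℕ) {n i : ℕ} (hi : sideLength n ≤ i) (hi' : i ≤ 2 * sideLength n) :
    prefixPoint L (snowflakeLoopWord n) i = sidePoint L .t .s n (2 * sideLength n - i) := by
  obtain ⟨k, rfl⟩ := Nat.exists_eq_add_of_le hi
  have h1 := eval_append L ((snowflakeWord .t .s n).take (sideLength n - k))
    ((snowflakeWord .t .s n).drop (sideLength n - k))
  rw [List.take_append_drop, eval_snowflakeWord L stablePair_st.symm] at h1
  rw [prefixPoint, snowflakeLoopWord]
  conv_lhs => rw [← length_snowflakeWord .s .t n, List.take_length_add_append, take_invRev,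
    eval_append, eval_invRev, eval_snowflakeWord L stablePair_st, length_snowflakeWord, h1]
  rw [mul_inv_cancel_right, show 2 * sideLength n - (sideLength n + k) = sideLength n - k by omega]
  rfl

/-- The snowflake loops are isometrically embedded on vertices. -/
theorem vertexDist_loopPoint {L : ℕ} (hL : 6 ≤ L) {n i j : ℕ} (hij : i ≤ j)
    (hj : j ≤ 2 * sideLength n) :
    vertexDist L (prefixPoint L (snowflakeLoopWord n) i) (prefixPoint L (snowflakeLoopWord n) j) =
      min (j - i) (2 * sideLength n - (j - i)) := by
  have hw := edgeLength_of_mem_snowflakeLoopWord L n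
  apply le_antisymm
  · refine le_min (vertexDist_prefixPoint_le hw hij) ?_
    have h1 := vertexDist_prefixPoint_le hw (Nat.zero_le i)
    have h2 := vertexDist_prefixPoint_le hw hj
    rw [loopPoint_first L (Nat.zero_le _), sidePoint_zero] at h1
    rw [loopPoint_second L (by omega) le_rfl, Nat.sub_self, sidePoint_zero] at h2
    have h3 := vertexDist_triangle L (prefixPoint L (snowflakeLoopWord n) i) 1
      (prefixPoint L (snowflakeLoopWord n) j)
    rw [vertexDist_comm L _ 1, vertexDist_comm L 1 (prefixPoint L (snowflakeLoopWord n) j)] at h3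
    omega
  rcases le_total j (sideLength n) with hj' | hj'
  · rw [loopPoint_first L hj', loopPoint_first L (hij.trans hj')]
    have := sub_le_vertexDist_sidePoint stablePair_st hL (i := i) hj'
    omega
  rcases le_total i (sideLength n) with hi' | hi'
  · rw [loopPoint_first L hi', loopPoint_second L hj' hj]
    have := le_vertexDist_sides hL n stablePair_st hi' (j := 2 * sideLength n - j) (by omega)
    omega
  · rw [loopPoint_second L hj' hj, loopPoint_second L hi' (by omega), vertexDist_comm]
    have := sub_le_vertexDist_sidePoint stablePair_st.symm hL (i := 2 * sideLength n - j)
      (show 2 * sideLength n - i ≤ sideLength n by omega)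
    omega

/-! ### From vertices to points of the graph -/

theorem dist_edgePoint_vertex_le (L : ℕ) (g : SnowflakeGroup L) (c : Gen) {τ : ℝ} (h0 : 0 ≤ τ)
    (h1 : τ ≤ edgeLength L c) : dist (edgePoint L g c τ) (vertex L g) ≤ τ ∧
      dist (edgePoint L g c τ) (vertex L (g * gen L c)) ≤ edgeLength L c - τ := by
  have hv : ∀ (p : EdgePoint L) (h : SnowflakeGroup L),
      dist (SeparationQuotient.mk p) (vertex L h) ≤ p.distVertex h := by
    intro p h
    rw [vertex, edgePoint, SeparationQuotient.dist_mk]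
    refine (EdgePoint.pathDist_le_distVia _ _).trans ((EdgePoint.distVia_le _ _ h).trans ?_)
    have := EdgePoint.distVertex_base
      (⟨h, .a, Set.projIcc 0 _ (Nat.cast_nonneg _) 0⟩ : EdgePoint L)
    simp only [Set.projIcc_left] at this ⊢
    linarith
  have hp : Set.projIcc 0 (edgeLength L c : ℝ) (Nat.cast_nonneg _) τ = ⟨τ, h0, h1⟩ :=
    Set.projIcc_of_mem _ ⟨h0, h1⟩
  rw [edgePoint, hp]
  exact ⟨(hv _ _).trans (EdgePoint.distVertex_base _),
    (hv _ _).trans (EdgePoint.distVertex_target _)⟩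

theorem dist_vertex (L : ℕ) (g h : SnowflakeGroup L) :
    dist (vertex L g) (vertex L h) = vertexDist L g h := by
  have hz : Set.projIcc (0 : ℝ) (edgeLength L .a : ℝ) (Nat.cast_nonneg _) 0 =
    ⟨0, le_rfl, Nat.cast_nonneg _⟩ := Set.projIcc_of_mem _ ⟨le_rfl, Nat.cast_nonneg _⟩
  rw [vertex, vertex, edgePoint, edgePoint, SeparationQuotient.dist_mk, hz]
  set p : EdgePoint L := ⟨g, .a, ⟨0, le_rfl, Nat.cast_nonneg _⟩⟩
  set q : EdgePoint L := ⟨h, .a, ⟨0, le_rfl, Nat.cast_nonneg _⟩⟩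
  have hp : p.distVertex g ≤ 0 := p.distVertex_base
  have hq : q.distVertex h ≤ 0 := q.distVertex_base
  change p.pathDist q = _
  apply le_antisymm
  · have h1 := (p.pathDist_le_distVia q).trans (p.distVia_le q h)
    have h2 := p.distVertex_triangle g h
    linarith
  · rcases p.pathDist_cases q with h1 | ⟨h1, -, h2⟩
    · obtain ⟨v, hv⟩ := p.exists_distVia q
      have k1 := p.vertexDist_le_distVertex_add g v
      have k2 := q.vertexDist_le_distVertex_add v h
      have k3 : (vertexDist L g h : ℝ) ≤ vertexDist L g v + vertexDist L v h := by
        exact_mod_cast vertexDist_triangle L g v h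
      linarith
    · have h3 : g = h := h1
      rw [h2, h3, vertexDist_self, Nat.cast_zero]
      exact abs_nonneg _

theorem edgePath_zero (L : ℕ) (g : SnowflakeGroup L) (w : Word) :
    edgePath L g w 0 = vertex L g := by
  rcases w with _ | ⟨⟨c, _ | _⟩, w⟩
  · rfl
  · rw [edgePath, if_pos (Nat.cast_nonneg _), sub_zero, ← dist_le_zero]
    simpa using (dist_edgePoint_vertex_le L (g * (gen L c)⁻¹) c (Nat.cast_nonneg _) le_rfl).2
  · rw [edgePath, if_pos (Nat.cast_nonneg _), ← dist_le_zero]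
    exact (dist_edgePoint_vertex_le L g c le_rfl (Nat.cast_nonneg _)).1

/-- A point of an edge path is at distance at most one from a vertex of the path. -/
theorem exists_dist_edgePath_le {L : ℕ} {w : Word} (hw : ∀ l ∈ w, edgeLength L l.1 = 1) :
    ∀ (g : SnowflakeGroup L) (τ : ℝ), 0 ≤ τ → τ ≤ w.length →
      ∃ i ≤ w.length, |τ - i| ≤ 1 ∧
        dist (edgePath L g w τ) (vertex L (g * prefixPoint L w i)) ≤ 1 := by
  induction w with
  | nil =>
    intro g τ h0 h1
    obtain rfl : τ = 0 := le_antisymm (by simpa using h1) h0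
    exact ⟨0, le_rfl, by simp, by simp [edgePath, prefixPoint, eval_nil]⟩
  | cons l w ih =>
    intro g τ h0 h1
    have hl := hw l List.mem_cons_self
    have ih := ih fun l hl => hw l (List.mem_cons_of_mem _ hl)
    rw [List.length_cons, Nat.cast_add_one] at h1
    obtain ⟨c, ε⟩ := l
    rcases le_or_gt τ 1 with h | h
    · refine ⟨0, Nat.zero_le _, by simpa [abs_of_nonneg h0] using h, ?_⟩
      rw [prefixPoint, List.take_zero, eval_nil, mul_one]
      cases ε with
      | true =>
        have h2 := (dist_edgePoint_vertex_le L g c h0 (by simpa [hl] using h)).1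
        rw [edgePath, if_pos (by simpa [hl] using h)]
        exact h2.trans h
      | false =>
        have h2 := (dist_edgePoint_vertex_le L (g * (gen L c)⁻¹) c (τ := edgeLength L c - τ)
          (by simpa [hl] using h) (by linarith)).2
        rw [edgePath, if_pos (by simpa [hl] using h)]
        rw [inv_mul_cancel_right] at h2
        linarith
    · have hc : (edgeLength L c : ℝ) = 1 := by exact_mod_cast hl
      cases ε with
      | true =>
        obtain ⟨i, hi, h2, h3⟩ := ih (g * gen L c) (τ - 1) (by linarith) (by linarith)
        refine ⟨i + 1, by simpa using hi,
          by push_cast; rwa [show τ - (i + 1) = τ - 1 - i by ring], ?_⟩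
        rw [edgePath, hc, if_neg (not_le.2 h), prefixPoint, List.take_succ_cons, eval_cons_true,
          ← mul_assoc]
        exact h3
      | false =>
        obtain ⟨i, hi, h2, h3⟩ := ih (g * (gen L c)⁻¹) (τ - 1) (by linarith) (by linarith)
        refine ⟨i + 1, by simpa using hi,
          by push_cast; rwa [show τ - (i + 1) = τ - 1 - i by ring], ?_⟩
        rw [edgePath, hc, if_neg (not_le.2 h), prefixPoint, List.take_succ_cons, eval_cons_false,
          ← mul_assoc]
        exact h3

/-- The distance between points of a snowflake loop is their distance along the loop, up to an
error of at most `4`. -/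
theorem abs_dist_snowflakeLoop_sub_le {L : ℕ} (hL : 6 ≤ L) (n : ℕ) {τ τ' : ℝ}
    (hτ : τ ∈ Set.Icc (0 : ℝ) (2 * sideLength n)) (hτ' : τ' ∈ Set.Icc (0 : ℝ) (2 * sideLength n)) :
    |dist (snowflakeLoop L n τ) (snowflakeLoop L n τ') -
      min |τ - τ'| (2 * sideLength n - |τ - τ'|)| ≤ 4 := by
  have hw := edgeLength_of_mem_snowflakeLoopWord L n
  have hlen := length_snowflakeLoopWord n
  have hlen' : ((snowflakeLoopWord n).length : ℝ) = 2 * sideLength n := by rw [hlen]; push_cast; rfl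
  obtain ⟨i, hi, h1, h2⟩ := exists_dist_edgePath_le hw 1 τ hτ.1 (hτ.2.trans_eq hlen'.symm)
  obtain ⟨j, hj, h3, h4⟩ := exists_dist_edgePath_le hw 1 τ' hτ'.1 (hτ'.2.trans_eq hlen'.symm)
  rw [one_mul] at h2 h4
  have key : dist (vertex L (prefixPoint L (snowflakeLoopWord n) i))
      (vertex L (prefixPoint L (snowflakeLoopWord n) j)) =
      min |(i : ℝ) - j| (2 * sideLength n - |(i : ℝ) - j|) := by
    have main : ∀ i j : ℕ, i ≤ j → j ≤ 2 * sideLength n →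
        dist (vertex L (prefixPoint L (snowflakeLoopWord n) i))
        (vertex L (prefixPoint L (snowflakeLoopWord n) j)) =
        min |(i : ℝ) - j| (2 * sideLength n - |(i : ℝ) - j|) := by
      intro i j hij hj
      have hij' : (i : ℝ) ≤ j := by exact_mod_cast hij
      rw [dist_vertex, vertexDist_loopPoint hL hij hj, abs_sub_comm, abs_of_nonneg (by linarith),
        Nat.cast_min, Nat.cast_sub hij, Nat.cast_sub (by omega), Nat.cast_sub hij]
      push_cast
      rfl
    rcases le_total i j with hij | hij
    · exact main i j hij (hj.trans_eq hlen)
    · rw [dist_comm, abs_sub_comm]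
      exact main j i hij (hi.trans_eq hlen)
  have hd : |dist (snowflakeLoop L n τ) (snowflakeLoop L n τ') -
      dist (vertex L (prefixPoint L (snowflakeLoopWord n) i))
      (vertex L (prefixPoint L (snowflakeLoopWord n) j))| ≤ 2 := by
    have := dist_dist_dist_le (snowflakeLoop L n τ) (snowflakeLoop L n τ')
      (vertex L (prefixPoint L (snowflakeLoopWord n) i))
      (vertex L (prefixPoint L (snowflakeLoopWord n) j))
    rw [Real.dist_eq] at this
    simp only [snowflakeLoop] at this ⊢
    linarith
  have hm : abs (|(i : ℝ) - j| - |τ - τ'|) ≤ 2 := by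
    refine (abs_abs_sub_abs_le_abs_sub _ _).trans ?_
    have h5 : (i : ℝ) - j - (τ - τ') = -(τ - i) + (τ' - j) := by ring
    rw [h5]
    refine (abs_add_le _ _).trans ?_
    rw [abs_neg]
    linarith
  rw [key] at hd
  rw [abs_le] at hd hm ⊢
  rcases min_cases |(i : ℝ) - j| (2 * sideLength n - |(i : ℝ) - j|) with ⟨e1, e1'⟩ | ⟨e1, e1'⟩ <;>
  rcases min_cases |τ - τ'| (2 * sideLength n - |τ - τ'|) with ⟨e2, e2'⟩ | ⟨e2, e2'⟩ <;>
  rw [e1] at hd <;> rw [e2] <;> constructor <;> linarith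

/-! ### The circle in the asymptotic cone -/

theorem snowflakeScaling_seq (L n : ℕ) :
    (snowflakeScaling L).seq n = 2 * sideLength (n + 1) := by
  change ((wordLength L (snowflakeLoopWord (n + 1)) : ℕ) : ℝ) = _
  rw [wordLength_eq_length (edgeLength_of_mem_snowflakeLoopWord L _), length_snowflakeLoopWord]
  push_cast
  rfl

theorem tendsto_dist_snowflakeLoop {L : ℕ} (hL : 6 ≤ L) {τ τ' : ℝ}
    (hτ : τ ∈ Set.Icc (0 : ℝ) 1) (hτ' : τ' ∈ Set.Icc (0 : ℝ) 1) :
    Tendsto (fun n => dist (snowflakeLoop L (n + 1) (τ * (snowflakeScaling L).seq n))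
      (snowflakeLoop L (n + 1) (τ' * (snowflakeScaling L).seq n)) / (snowflakeScaling L).seq n)
      atTop (𝓝 (min |τ - τ'| (1 - |τ - τ'|))) := by
  rw [tendsto_iff_dist_tendsto_zero]
  refine squeeze_zero (fun _ => dist_nonneg) (fun n => ?_)
    ((snowflakeScaling L).tendsto.const_div_atTop 4)
  have hs := (snowflakeScaling L).pos n
  have hmem : ∀ {τ : ℝ}, τ ∈ Set.Icc (0 : ℝ) 1 →
      τ * (snowflakeScaling L).seq n ∈ Set.Icc (0 : ℝ) (2 * sideLength (n + 1)) := by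
    intro τ hτ
    rw [← snowflakeScaling_seq L]
    exact ⟨mul_nonneg hτ.1 hs.le, mul_le_of_le_one_left hs.le hτ.2⟩
  have h := abs_dist_snowflakeLoop_sub_le hL (n + 1) (hmem hτ) (hmem hτ')
  have hmin : min |τ * (snowflakeScaling L).seq n - τ' * (snowflakeScaling L).seq n|
      ((snowflakeScaling L).seq n -
        |τ * (snowflakeScaling L).seq n - τ' * (snowflakeScaling L).seq n|) =
      min |τ - τ'| (1 - |τ - τ'|) * (snowflakeScaling L).seq n := by
    rw [← sub_mul, abs_mul, abs_of_pos hs, min_mul_of_nonneg _ _ hs.le, sub_mul, one_mul]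
  rw [← snowflakeScaling_seq L, hmin] at h
  rw [Real.dist_eq, div_sub' hs.ne', abs_div, abs_of_pos hs, mul_comm (_ : ℝ) (min _ _)]
  gcongr

theorem unitAddCircle_dist_coe {τ τ' : ℝ} (hτ : τ ∈ Set.Icc (0 : ℝ) 1)
    (hτ' : τ' ∈ Set.Icc (0 : ℝ) 1) :
    dist (τ : UnitAddCircle) τ' = min |τ - τ'| (1 - |τ - τ'|) := by
  wlog h : τ' ≤ τ generalizing τ τ'
  · rw [dist_comm, abs_sub_comm]
    exact this hτ' hτ (le_of_not_ge h)
  rw [dist_eq_norm, ← AddCircle.coe_sub, UnitAddCircle.norm_eq, abs_of_nonneg (sub_nonneg.2 h),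
    abs_sub_round_eq_min]
  rcases (show τ - τ' ≤ 1 by linarith [hτ.2, hτ'.1]).lt_or_eq with h1 | h1
  · rw [Int.fract_eq_self.2 ⟨sub_nonneg.2 h, h1⟩]
  · rw [h1]
    simp

theorem NonPrincipal.le_atTop {ω : Ultrafilter ℕ} (hω : NonPrincipal ω) :
    (ω : Filter ℕ) ≤ atTop := by
  rw [← Nat.cofinite_eq_atTop]
  exact ω.le_cofinite_or_eq_pure.resolve_right fun ⟨n, hn⟩ => hω n hn

/-- The sequence of the points at the parameter `τ` of the snowflake loops, with the parameter
rescaled to the unit interval. -/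
noncomputable def conePoint {L : ℕ} (hL : 6 ≤ L) {ω : Ultrafilter ℕ} (hω : NonPrincipal ω) (τ : ℝ)
    (hτ : τ ∈ Set.Icc (0 : ℝ) 1) :
    ConeSeq ω (fun _ => vertex L 1) (snowflakeScaling L) :=
  ⟨fun n => snowflakeLoop L (n + 1) (τ * (snowflakeScaling L).seq n), _, by
    have h := (tendsto_dist_snowflakeLoop hL hτ (Set.left_mem_Icc.2 zero_le_one)).mono_left
      hω.le_atTop
    simp only [zero_mul] at h
    simp only [snowflakeLoop, edgePath_zero] at h ⊢
    exact h⟩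

theorem dist_conePoint {L : ℕ} (hL : 6 ≤ L) {ω : Ultrafilter ℕ} (hω : NonPrincipal ω) {τ τ' : ℝ}
    (hτ : τ ∈ Set.Icc (0 : ℝ) 1) (hτ' : τ' ∈ Set.Icc (0 : ℝ) 1) :
    dist (conePoint hL hω τ hτ) (conePoint hL hω τ' hτ') = dist (τ : UnitAddCircle) τ' := by
  rw [unitAddCircle_dist_coe hτ hτ']
  exact tendsto_nhds_unique (ConeSeq.tendsto_coneDist _ _)
    ((tendsto_dist_snowflakeLoop hL hτ hτ').mono_left hω.le_atTop)

theorem exists_isometry_unitAddCircle {L : ℕ} (hL : 6 ≤ L) {ω : Ultrafilter ℕ}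
    (hω : NonPrincipal ω) :
    ∃ f : UnitAddCircle → AsymptoticCone ω (fun _ => vertex L 1) (snowflakeScaling L),
      Isometry f ∧ ∀ τ (hτ : τ ∈ Set.Icc (0 : ℝ) 1),
        f (τ : UnitAddCircle) = SeparationQuotient.mk (conePoint hL hω τ hτ) := by
  have hrep : ∀ z : UnitAddCircle, ∃ τ : ℝ, τ ∈ Set.Icc (0 : ℝ) 1 ∧ (τ : UnitAddCircle) = z := by
    intro z
    have h := (AddCircle.equivIco 1 0 z).2
    exact ⟨_, ⟨h.1, h.2.le.trans_eq (zero_add 1)⟩, (AddCircle.equivIco 1 0).symm_apply_apply z⟩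
  choose ρ hρ hρ' using hrep
  refine ⟨fun z => SeparationQuotient.mk (conePoint hL hω (ρ z) (hρ z)),
    Isometry.of_dist_eq fun z w => ?_, fun τ hτ => ?_⟩
  · rw [SeparationQuotient.dist_mk, dist_conePoint, hρ', hρ']
  · rw [← dist_eq_zero, SeparationQuotient.dist_mk, dist_conePoint, hρ', dist_self]

theorem nonPrincipal_hyperfilter : NonPrincipal (hyperfilter ℕ) := by
  intro n h
  have h1 := hyperfilter_le_cofinite (α := ℕ)
  rw [h] at h1
  have h2 : ({n}ᶜ : Set ℕ) ∈ (pure n : Filter ℕ) :=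
    h1 (Set.finite_singleton n).compl_mem_cofinite
  exact h2 rfl

end Snowflake

/-- For even `L ≥ 6`, some asymptotic cone of the snowflake graph `X_L` contains an isometrically
embedded circle of length one (with its length metric). More precisely, for every non-principal
ultrafilter, constant observation point `1` and scaling by the lengths of the snowflake loops,
the rescaled snowflake loops form such a circle in the asymptotic cone. -/
theorem corollary4p3 (L : ℕ) (hL : 6 ≤ L) (hL' : Even L) :
    (∃ (ω : Ultrafilter ℕ) (o : ℕ → Snowflake.SnowflakeGraph L) (s : Snowflake.ScalingSeq),
      Snowflake.NonPrincipal ω ∧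
      ∃ f : UnitAddCircle → Snowflake.AsymptoticCone ω o s, Isometry f) ∧
    ∀ ω : Ultrafilter ℕ, Snowflake.NonPrincipal ω →
      ∃ f : UnitAddCircle → Snowflake.AsymptoticCone ω (fun _ => Snowflake.vertex L 1)
          (Snowflake.snowflakeScaling L),
        Isometry f ∧
        ∀ τ ∈ Set.Icc (0 : ℝ) 1,
          ∃ p : Snowflake.ConeSeq ω (fun _ => Snowflake.vertex L 1) (Snowflake.snowflakeScaling L),
            (∀ n, p.1 n =
              Snowflake.snowflakeLoop L (n + 1) (τ * (Snowflake.snowflakeScaling L).seq n)) ∧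
            f (τ : UnitAddCircle) = SeparationQuotient.mk p := by

  have main : ∀ ω : Ultrafilter ℕ, Snowflake.NonPrincipal ω →
      ∃ f : UnitAddCircle → Snowflake.AsymptoticCone ω (fun _ => Snowflake.vertex L 1)
          (Snowflake.snowflakeScaling L),
        Isometry f ∧
        ∀ τ ∈ Set.Icc (0 : ℝ) 1,
          ∃ p : Snowflake.ConeSeq ω (fun _ => Snowflake.vertex L 1) (Snowflake.snowflakeScaling L),
            (∀ n, p.1 n =
              Snowflake.snowflakeLoop L (n + 1) (τ * (Snowflake.snowflakeScaling L).seq n)) ∧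
            f (τ : UnitAddCircle) = SeparationQuotient.mk p := by
    intro ω hω
    obtain ⟨f, hf, hfτ⟩ := Snowflake.exists_isometry_unitAddCircle hL hω
    exact ⟨f, hf, fun τ hτ => ⟨Snowflake.conePoint hL hω τ hτ, fun _ => rfl, hfτ τ hτ⟩⟩
  obtain ⟨f, hf, -⟩ := main _ Snowflake.nonPrincipal_hyperfilter
  exact ⟨⟨_, _, _, Snowflake.nonPrincipal_hyperfilter, f, hf⟩, main⟩
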